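/- Let $F$ be a non-archimedean local field of odd residue characteristic, let $D$ be the quaternion division algebra with center $F$ (with its natural topology as a finite-dimensional $F$-vector space), let $M$ be the unramified quadratic extension of $F$, and fix an embedding of $F$-algebras $M \hookrightarrow D$, so that $M^\times$ is a subgroup of the topological group $D^\times$. A \emph{2-fold cover} of a topological group $G$ is a topological central extension $1 \to \{\pm 1\} \to \widetilde G \to G \to 1$ that splits on a neighbourhood of the identity of $G$; the $\mathbb{C}^\times$-cover obtained from it is the central extension $1 \to \mathbb{C}^\times \to (\widetilde G \times \mathbb{C}^\times)/\langle(-1,-1)\rangle \to G \to 1$. A cover is said to split over a subgroup $H \subseteq G$ if there is a continuous homomorphism from $H$ to the total group of the cover lifting the inclusion $H \hookrightarrow G$, and to be non-trivial if it does not split over $G$. Let $\widetilde{D^\times}$ be a 2-fold cover of $D^\times$ such that the $\mathbb{C}^\times$-cover obtained from it is non-trivial. Then $\widetilde{D^\times}$ does not split over $M^\times$; moreover, the $\mathbb{C}^\times$-cover obtained from $\widetilde{D^\times}$ does not split over $M^\times$ either. -/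

import Mathlib

open scoped ValuativeRel Topology

/-- A 2-fold cover `1 → {±1} → E → G → 1` of a topological group `G`: a topological central
extension of `G` by the discrete group `{±1}` (written `ℤˣ`) which splits on a
neighbourhood of the identity. -/
structure TwoFoldCover (G E : Type*) [Group G] [TopologicalSpace G]
    [Group E] [TopologicalSpace E] [IsTopologicalGroup E] where
  /-- the inclusion of the kernel -/
  incl : ℤˣ →* E
  /-- the projection to the base -/
  proj : E →ₜ* G
  isEmbedding_incl : Topology.IsEmbedding incl
  proj_surjective : Function.Surjective proj
  exact : incl.range = proj.toMonoidHom.ker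
  central : incl.range ≤ Subgroup.center E
  locally_split : ∃ U ∈ 𝓝 (1 : G), ∃ s : G → E, ContinuousOn s U ∧
    (∀ x ∈ U, proj (s x) = x) ∧
    ∀ x ∈ U, ∀ y ∈ U, x * y ∈ U → s (x * y) = s x * s y

/-- The extension with projection `p : E → G` splits: `p` has a continuous section that is a
group homomorphism. For a central extension this says that it is trivial. -/
def ExtensionSplits {G E : Type*} [Group G] [TopologicalSpace G] [Group E] [TopologicalSpace E]
    (p : E →* G) : Prop :=
  ∃ s : G →ₜ* E, ∀ g : G, p (s g) = g

/-- The extension with projection `p : E → G` splits over the subgroup `H` of `G`, where `H`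
carries the subspace topology. -/
def ExtensionSplitsOver {G E : Type*} [Group G] [TopologicalSpace G] [Group E]
    [TopologicalSpace E] (p : E →* G) (H : Subgroup G) : Prop :=
  ∃ s : H →ₜ* E, ∀ h : H, p (s h) = h

namespace TwoFoldCover

variable {G E : Type*} [Group G] [TopologicalSpace G]
  [Group E] [TopologicalSpace E] [IsTopologicalGroup E]

/-- The subgroup `⟨(-1, -1)⟩` of `E × ℂˣ`. -/
def antidiagonal (c : TwoFoldCover G E) : Subgroup (E × ℂˣ) :=
  Subgroup.zpowers (c.incl (-1), -1)

instance antidiagonal_normal (c : TwoFoldCover G E) : c.antidiagonal.Normal := by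
  have h : ∀ g : E × ℂˣ, Commute g (c.incl (-1), -1) := fun g =>
    Prod.ext (Subgroup.mem_center_iff.1 (c.central ⟨-1, rfl⟩) g.1) (mul_comm _ _)
  refine ⟨?_⟩
  rintro _ ⟨n, rfl⟩ g
  refine ⟨n, ?_⟩
  have := ((h g).zpow_right n).eq
  simp only [this, mul_inv_cancel_right]

/-- The total group `(E × ℂˣ) / ⟨(-1, -1)⟩` of the `ℂˣ`-cover obtained from a 2-fold cover,
with the quotient topology. -/
abbrev ComplexTotal (c : TwoFoldCover G E) : Type _ := (E × ℂˣ) ⧸ c.antidiagonal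

/-- The projection of the `ℂˣ`-cover obtained from a 2-fold cover, `[(x, z)] ↦ proj x`. -/
def complexProj (c : TwoFoldCover G E) : c.ComplexTotal →* G :=
  QuotientGroup.lift c.antidiagonal (c.proj.toMonoidHom.comp (MonoidHom.fst E ℂˣ)) (by
    have h : c.incl (-1) ∈ c.proj.toMonoidHom.ker := c.exact ▸ ⟨-1, rfl⟩
    rw [antidiagonal, Subgroup.zpowers_le]
    exact h)

end TwoFoldCover

/-- A finite extension `M` of a non-archimedean local field `F` is unramified: the ring of
integers of `M`, that is the integral closure of `𝒪[F]` in `M`, is unramified over `𝒪[F]`. -/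
def IsUnramifiedExtension (F M : Type*) [Field F] [ValuativeRel F] [Field M] [Algebra F M] :
    Prop :=
  Algebra.FormallyUnramified 𝒪[F] (integralClosure 𝒪[F] M)

/-! The quaternion algebra `D` is `M ⊕ M j`, where `M = F(√ε)` for a nonsquare unit `ε`, `j²` is a
uniformizer of `F` and `j` acts on `M` by conjugation. The principal units `1 + 𝔓` form a pro-`p`
group with `p` odd, so a 2-fold cover splits canonically over them; dividing out this splitting
leaves a central extension by `ℂˣ` of the group `Dˣ / (1 + 𝔓)`, which is generated by `j` and a
generator `ζ` of the multiplicative group of the residue field of `M`, subject to the relations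
`j ζ j⁻¹ = ζ ^ q` and `ζ ^ (q ^ 2 - 1) = 1`. A splitting over `Mˣ` makes the lifts of `ζ` and `j²`
commute. Since `ℂˣ` is divisible, the lift of `ζ` can be rescaled to satisfy the first relation, and
commutation with `j²` then forces the second one: the extension splits over `Dˣ`. -/

section Lifts

variable {X Y : Type*} [Group X] [Group Y]

/-- `S` is a lift of the subgroup `U` of `Y` along `p : X →* Y`, that is, `p` maps `S`
isomorphically onto `U`. Lifts of `U` are the ranges of the splittings of `p` over `U`. -/
structure IsLift (p : X →* Y) (S : Subgroup X) (U : Subgroup Y) : Prop where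
  map_eq : S.map p = U
  disjoint_ker : Disjoint S p.ker

namespace IsLift

variable {p : X →* Y} {S T : Subgroup X} {U V : Subgroup Y}

theorem eq_one (h : IsLift p S U) {x : X} (hx : x ∈ S) (hpx : p x = 1) : x = 1 :=
  Subgroup.disjoint_def.1 h.disjoint_ker hx hpx

theorem le_comap (h : IsLift p S U) : S ≤ U.comap p :=
  Subgroup.map_le_iff_le_comap.1 h.map_eq.le

theorem comap_eq_sup_ker (h : IsLift p S U) : U.comap p = S ⊔ p.ker := by
  rw [← h.map_eq, Subgroup.comap_map_eq]

theorem conj_mem_of_conj_pow_mem (h : IsLift p S U) (hU : U.Normal)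
    (hp : p.ker ≤ Subgroup.center X) {m : ℕ} (hm : m.Coprime (Nat.card p.ker)) {x g : X}
    (hx : x ∈ S) (hxg : g * x ^ m * g⁻¹ ∈ S) : g * x * g⁻¹ ∈ S := by
  have hpx : p (g * x * g⁻¹) ∈ S.map p := by
    rw [h.map_eq, map_mul, map_mul, map_inv]
    exact hU.conj_mem _ (h.le_comap hx) _
  obtain ⟨y, hy, hyx⟩ := hpx
  set k := g * x * g⁻¹ * y⁻¹ with hk
  have hgx : g * x * g⁻¹ = k * y := (inv_mul_cancel_right _ _).symm
  have hk_ker : k ∈ p.ker := by rw [MonoidHom.mem_ker, hk, map_mul, map_inv, hyx, mul_inv_cancel]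
  have hky : Commute k y := (Subgroup.mem_center_iff.1 (hp hk_ker) y).symm
  have hkS : k ^ m ∈ S := by
    rw [← conj_pow, hgx, hky.mul_pow] at hxg
    exact (Subgroup.mul_mem_cancel_right _ (pow_mem hy m)).1 hxg
  have hkm : k ^ m = 1 := h.eq_one hkS (pow_mem hk_ker m)
  have hk1 : k = 1 := orderOf_eq_one_iff.1 <| Nat.eq_one_of_dvd_coprimes hm
    (orderOf_dvd_of_pow_eq_one hkm) (Subgroup.orderOf_dvd_natCard _ hk_ker)
  rwa [hgx, hk1, one_mul]

/-- Schur–Zassenhaus, relative to a lift of a smaller subgroup. -/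
theorem exists_ge_of_range [T.Normal] (h : IsLift p T V)
    (hV : (Nat.card p.ker).Coprime (V.relIndex p.range)) :
    ∃ S, T ≤ S ∧ IsLift p S p.range := by
  let π := QuotientGroup.mk' T
  have hπ : Function.Surjective π := QuotientGroup.mk'_surjective T
  have hπ_ker : π.ker = T := QuotientGroup.ker_mk' T
  have hK : (p.ker.map π).Normal := Subgroup.Normal.map inferInstance π hπ
  have hinj : Set.InjOn π p.ker := fun x hx y hy hxy => inv_mul_eq_one.1 <|
    h.eq_one (QuotientGroup.eq.1 hxy) (mul_mem (inv_mem hx) hy)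
  have hcard : Nat.card (p.ker.map π) = Nat.card p.ker :=
    Nat.card_image_of_injOn hinj
  have hcomap : (p.ker.map π).comap π = p.ker ⊔ T := by rw [Subgroup.comap_map_eq, hπ_ker]
  have hindex : (p.ker.map π).index = V.relIndex p.range := by
    rw [← Subgroup.index_comap, h.comap_eq_sup_ker, ← Subgroup.index_comap_of_surjective _ hπ,
      hcomap, sup_comm]
  obtain ⟨H, hH⟩ := Subgroup.exists_left_complement'_of_coprime (N := p.ker.map π)
    (by rwa [hcard, hindex])
  have hTH : T ≤ H.comap π := hπ_ker.ge.trans (π.ker_le_comap H)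
  refine ⟨H.comap π, hTH, ?_, ?_⟩
  · have hsup : H.comap π ⊔ p.ker = ⊤ := by
      rw [← sup_eq_left.2 hTH, sup_assoc, sup_comm T, ← hcomap,
        Subgroup.comap_sup_eq π _ _ hπ, hH.sup_eq_top, Subgroup.comap_top]
    have hker : p.ker.map p = ⊥ := (p.ker.map_eq_bot_iff).2 le_rfl
    rw [MonoidHom.range_eq_map, ← hsup, Subgroup.map_sup, hker, sup_bot_eq]
  · refine Subgroup.disjoint_def.2 fun {x} hxH hxK => h.eq_one ?_ hxK
    rw [← hπ_ker, MonoidHom.mem_ker]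
    exact Subgroup.disjoint_def.1 hH.disjoint hxH (Subgroup.mem_map_of_mem π hxK)

theorem exists_ge [T.Normal] (h : IsLift p T V) (hVU : V ≤ U) (hU : U ≤ p.range)
    (hV : (Nat.card p.ker).Coprime (V.relIndex U)) : ∃ S, T ≤ S ∧ IsLift p S U := by
  let P := U.comap p
  let f := p.comp P.subtype
  have hf : f.range = U := by
    rw [MonoidHom.range_comp, Subgroup.range_subtype, Subgroup.map_comap_eq_self hU]
  have hTP : T ≤ P := h.le_comap.trans (Subgroup.comap_mono hVU)
  have hT : IsLift f (T.subgroupOf P) V := by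
    refine ⟨?_, Subgroup.disjoint_def.2 fun {x} hx hfx => Subtype.ext (h.eq_one hx hfx)⟩
    rw [← Subgroup.map_map, Subgroup.subgroupOf_map_subtype, inf_eq_left.2 hTP, h.map_eq]
  have hcard : Nat.card f.ker = Nat.card p.ker :=
    Nat.card_congr (Subgroup.subgroupOfEquivOfLe (p.ker_le_comap U)).toEquiv
  obtain ⟨S, hTS, hS⟩ := hT.exists_ge_of_range (by rwa [hcard, hf])
  refine ⟨S.map P.subtype, ?_, ?_, ?_⟩
  · rw [← inf_eq_left.2 hTP, ← Subgroup.subgroupOf_map_subtype]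
    exact Subgroup.map_mono hTS
  · rw [Subgroup.map_map, hS.map_eq, hf]
  · rw [Subgroup.disjoint_def]
    rintro _ ⟨x, hx, rfl⟩ hpx
    rw [hS.eq_one hx hpx, map_one]

section Quotient

variable [S.Normal] [U.Normal]

theorem ker_quotientMap (h : IsLift p S U) :
    (QuotientGroup.map S U p h.le_comap).ker = p.ker.map (QuotientGroup.mk' S) := by
  rw [QuotientGroup.ker_map, h.comap_eq_sup_ker, Subgroup.map_sup,
    QuotientGroup.map_mk'_self, bot_sup_eq]

theorem comap_mk' (h : IsLift p S U) {H : Subgroup (X ⧸ S)}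
    (hH : IsLift (QuotientGroup.map S U p h.le_comap) H ⊤) :
    IsLift p (H.comap (QuotientGroup.mk' S)) ⊤ := by
  have hSH : S ≤ H.comap (QuotientGroup.mk' S) := by
    simpa only [QuotientGroup.ker_mk'] using (QuotientGroup.mk' S).ker_le_comap H
  refine ⟨?_, Subgroup.disjoint_def.2 fun {x} hxH hpx => h.eq_one ?_ hpx⟩
  · rw [eq_top_iff]
    rintro y -
    obtain ⟨x', hx', hxy⟩ : (y : Y ⧸ U) ∈ H.map (QuotientGroup.map S U p h.le_comap) :=
      hH.map_eq ▸ Subgroup.mem_top _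
    obtain ⟨x, rfl⟩ := QuotientGroup.mk_surjective x'
    obtain ⟨s, hs, hsx⟩ : (p x)⁻¹ * y ∈ S.map p := h.map_eq ▸ QuotientGroup.eq.1 hxy
    exact ⟨x * s, mul_mem hx' (hSH hs), by rw [map_mul, hsx, mul_inv_cancel_left]⟩
  · rw [← QuotientGroup.eq_one_iff]
    refine hH.eq_one hxH ?_
    rw [QuotientGroup.map_mk, hpx, QuotientGroup.mk_one]

end Quotient

end IsLift

end Lifts

section Metacyclic

variable {X Y : Type*} [Group X] [Group Y]

theorem commute_of_map_eq {p : X →* Y} (hp : p.ker ≤ Subgroup.center X) {a a' b b' : X}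
    (hab : Commute a b) (ha : p a' = p a) (hb : p b' = p b) : Commute a' b' := by
  have key : ∀ {x x' : X}, p x' = p x → ∀ {y}, Commute x y → Commute x' y := by
    intro x x' hx y hxy
    have hk : x' * x⁻¹ ∈ p.ker := by rw [MonoidHom.mem_ker, map_mul, map_inv, hx, mul_inv_cancel]
    rw [← inv_mul_cancel_right x' x]
    exact Commute.mul_left (Subgroup.mem_center_iff.1 (hp hk) y).symm hxy
  exact (key hb (key ha hab).symm).symm

theorem mem_normalizer_zpowers {a b : X} (h : b * a * b⁻¹ ∈ Subgroup.zpowers a)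
    (h' : b⁻¹ * a * b ∈ Subgroup.zpowers a) :
    b ∈ Subgroup.normalizer (Subgroup.zpowers a : Set X) := by
  rw [Subgroup.mem_normalizer_iff]
  have hconj : ∀ c : X, c * a * c⁻¹ ∈ Subgroup.zpowers a → ∀ x ∈ Subgroup.zpowers a,
      c * x * c⁻¹ ∈ Subgroup.zpowers a := by
    rintro c hc _ ⟨i, rfl⟩
    simpa only [conj_zpow] using zpow_mem hc i
  refine fun x => ⟨hconj b h x, fun hx => ?_⟩
  simpa [mul_assoc] using hconj b⁻¹ (by rwa [inv_inv]) _ hx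

section ConjEqPow

variable {a b : X} {q : ℕ}

theorem inv_conj_eq_pow (hab : Commute a (b ^ 2)) (h : b * a * b⁻¹ = a ^ q) :
    b⁻¹ * a * b = a ^ q := by
  have hb : a * b ^ 2 = b ^ 2 * a := hab
  rw [← h, eq_mul_inv_iff_mul_eq, mul_assoc, mul_assoc, ← pow_two, hb, pow_two]
  group

theorem pow_sq_sub_one_eq_one (hq : 0 < q) (hab : Commute a (b ^ 2)) (h : b * a * b⁻¹ = a ^ q) :
    a ^ (q ^ 2 - 1) = 1 := by
  have ha : a = a ^ q ^ 2 := calc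
    a = b ^ 2 * a * (b ^ 2)⁻¹ := by rw [← hab.eq, mul_inv_cancel_right]
    _ = b * (b * a * b⁻¹) * b⁻¹ := by rw [pow_two, mul_inv_rev]; simp only [mul_assoc]
    _ = a ^ q ^ 2 := by rw [h, ← conj_pow, h, ← pow_mul, pow_two]
  have hq2 : q ^ 2 = q ^ 2 - 1 + 1 := (Nat.sub_add_cancel (Nat.pow_pos hq)).symm
  rw [hq2, pow_succ] at ha
  exact right_eq_mul.1 ha

theorem le_normalizer_zpowers (hab : Commute a (b ^ 2)) (h : b * a * b⁻¹ = a ^ q) :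
    Subgroup.zpowers b ≤ Subgroup.normalizer (Subgroup.zpowers a : Set X) := by
  rw [Subgroup.zpowers_le]
  refine mem_normalizer_zpowers ⟨q, ?_⟩ ⟨q, ?_⟩
  · exact (zpow_natCast a q).trans h.symm
  · exact (zpow_natCast a q).trans (inv_conj_eq_pow hab h).symm

end ConjEqPow

variable {p : X →* Y}

theorem exists_lift_conj_eq_pow (hker : p.ker ≤ Subgroup.center X)
    (hdiv : ∀ n ≠ 0, ∀ x ∈ p.ker, ∃ y ∈ p.ker, y ^ n = x) {q : ℕ} (hq : 1 < q) {a₀ b : X}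
    (h : p (b * a₀ * b⁻¹) = p (a₀ ^ q)) : ∃ a, p a = p a₀ ∧ b * a * b⁻¹ = a ^ q := by
  have ht : b * a₀ * b⁻¹ * (a₀ ^ q)⁻¹ ∈ p.ker := by
    rw [MonoidHom.mem_ker, map_mul, h, map_inv, mul_inv_cancel]
  obtain ⟨d, hd, hdq⟩ := hdiv (q - 1) (Nat.sub_ne_zero_of_lt hq) _ ht
  have hd_central : ∀ x, Commute d x := fun x => (Subgroup.mem_center_iff.1 (hker hd) x).symm
  refine ⟨d * a₀, by rw [map_mul, hd, one_mul], ?_⟩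
  calc b * (d * a₀) * b⁻¹ = d * (b * a₀ * b⁻¹) := by
        rw [← mul_assoc, ← (hd_central b).eq]; simp only [mul_assoc]
    _ = d * d ^ (q - 1) * a₀ ^ q := by rw [hdq, mul_assoc d, inv_mul_cancel_right]
    _ = (d * a₀) ^ q := by rw [← pow_succ', Nat.sub_add_cancel hq.le, (hd_central a₀).mul_pow]

/-- A lift of `z` can be corrected by an element of the kernel so as to satisfy the same relation
`w z w⁻¹ = z ^ q`; its order then divides `q ^ 2 - 1` because it commutes with the square of any
lift of `w`. -/
theorem exists_isLift_top_of_commute (hp : Function.Surjective p)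
    (hker : p.ker ≤ Subgroup.center X)
    (hdiv : ∀ n ≠ 0, ∀ x ∈ p.ker, ∃ y ∈ p.ker, y ^ n = x) {z w : Y} {q : ℕ} (hq : 1 < q)
    (hzw : w * z * w⁻¹ = z ^ q) (hz : q ^ 2 - 1 ∣ orderOf z)
    (hw : ∀ k : ℤ, w ^ k ∈ Subgroup.zpowers z → k = 0)
    (htop : Subgroup.zpowers w ⊔ Subgroup.zpowers z = ⊤) {a₀ b₀ : X} (ha₀ : p a₀ = z)
    (hb₀ : p b₀ = w ^ 2) (hab₀ : Commute a₀ b₀) : ∃ H, IsLift p H ⊤ := by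
  obtain ⟨b, rfl⟩ := hp w
  subst ha₀
  obtain ⟨a, ha, hba⟩ := exists_lift_conj_eq_pow hker hdiv hq (a₀ := a₀) (b := b)
    (by rw [map_mul, map_mul, map_inv, map_pow, hzw])
  have hab : Commute a (b ^ 2) := commute_of_map_eq hker hab₀ ha (by rw [hb₀, map_pow])
  refine ⟨Subgroup.zpowers b ⊔ Subgroup.zpowers a, ?_, Subgroup.disjoint_def.2 fun {x} hx hpx => ?_⟩
  · rw [Subgroup.map_sup, MonoidHom.map_zpowers, MonoidHom.map_zpowers, ha, htop]
  · have hx' : x ∈ ((Subgroup.zpowers b ⊔ Subgroup.zpowers a : Subgroup X) : Set X) := hx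
    rw [Subgroup.coe_mul_of_left_le_normalizer_right _ _ (le_normalizer_zpowers hab hba)] at hx'
    obtain ⟨_, ⟨k, rfl⟩, _, ⟨i, rfl⟩, rfl⟩ := hx'
    have hki : p b ^ k * p a₀ ^ i = 1 := by
      simpa only [map_mul, map_zpow, ha] using MonoidHom.mem_ker.1 hpx
    obtain rfl : k = 0 := hw k
      (eq_inv_of_mul_eq_one_left hki ▸ inv_mem (Subgroup.zpow_mem_zpowers _ i))
    rw [zpow_zero, one_mul] at hki
    have hi : ((q ^ 2 - 1 : ℕ) : ℤ) ∣ i :=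
      (Int.natCast_dvd_natCast.2 hz).trans (orderOf_dvd_iff_zpow_eq_one.2 hki)
    obtain ⟨r, rfl⟩ := hi
    simp only [zpow_zero, one_mul, zpow_mul, zpow_natCast,
      pow_sq_sub_one_eq_one (Nat.zero_lt_of_lt hq) hab hba, one_zpow]

end Metacyclic

section TopologicalExtensions

variable {G E : Type*} [Group G] [TopologicalSpace G] [Group E] [TopologicalSpace E]

/-- The extension `p : E → G` has a section near `1` that is continuous at `1` and takes values
in `S`. -/
def HasLocalSectionIn (p : E →* G) (S : Subgroup E) : Prop :=
  ∃ s : G → E, ContinuousAt s 1 ∧ ∀ᶠ x in 𝓝 1, s x ∈ S ∧ p (s x) = x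

/-- The normal subgroups of `G` that are contained in `U` with odd index are neighbourhoods of `1`
which form a basis. When `U` is compact and totally disconnected, this makes it pro-odd. -/
def HasOddNormalBasis (U : Subgroup G) : Prop :=
  ∀ W ∈ 𝓝 (1 : G), ∃ V : Subgroup G, (V : Set G) ∈ 𝓝 1 ∧ (V : Set G) ⊆ W ∧ V.Normal ∧ V ≤ U ∧
    Odd (V.relIndex U)

theorem HasOddNormalBasis.of_le {U V : Subgroup G} (hU : HasOddNormalBasis U)
    (hV : (V : Set G) ∈ 𝓝 1) (hVU : V ≤ U) : HasOddNormalBasis V := fun W hW => by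
  obtain ⟨V', hV', hV'W, hn, -, hodd⟩ := hU _ (Filter.inter_mem hV hW)
  have hV'V : V' ≤ V := fun x hx => (hV'W hx).1
  rw [← Subgroup.relIndex_mul_relIndex V' V U hV'V hVU] at hodd
  exact ⟨V', hV', fun x hx => (hV'W hx).2, hn, hV'V, (Nat.odd_mul.1 hodd).1⟩

theorem IsLift.extensionSplits [IsTopologicalGroup G] [IsTopologicalGroup E] {p : E →* G}
    {S : Subgroup E} (hS : IsLift p S ⊤) (hp : HasLocalSectionIn p S) : ExtensionSplits p := by
  obtain ⟨s, hs, hsS⟩ := hp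
  have hbij : Function.Bijective (p.comp S.subtype) := by
    refine ⟨(injective_iff_map_eq_one _).2 fun x hx => Subtype.ext (hS.eq_one x.2 hx), fun g => ?_⟩
    obtain ⟨x, hx, hxg⟩ : g ∈ S.map p := hS.map_eq ▸ Subgroup.mem_top g
    exact ⟨⟨x, hx⟩, hxg⟩
  let e : S ≃* G := MulEquiv.ofBijective _ hbij
  let σ : G →* E := S.subtype.comp e.symm.toMonoidHom
  have hσ : ContinuousAt σ 1 := hs.congr <| hsS.mono fun x ⟨hxS, hx⟩ =>
    congrArg Subtype.val (e.eq_symm_apply.2 hx : (⟨s x, hxS⟩ : S) = e.symm x)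
  exact ⟨⟨σ, continuous_of_continuousAt_one σ hσ⟩, e.apply_symm_apply⟩

end TopologicalExtensions

namespace TwoFoldCover

variable {G E : Type*} [Group G] [TopologicalSpace G] [Group E] [TopologicalSpace E]
  [IsTopologicalGroup E] (c : TwoFoldCover G E)

theorem ker_proj_le_center : c.proj.toMonoidHom.ker ≤ Subgroup.center E :=
  c.exact ▸ c.central

theorem natCard_ker_proj : Nat.card c.proj.toMonoidHom.ker = 2 := by
  rw [← c.exact, Nat.card_congr (MonoidHom.ofInjective c.isEmbedding_incl.injective).symm.toEquiv,
    Nat.card_eq_fintype_card, Fintype.card_units_int]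

theorem eventually_eq_one_of_proj_eq_one : ∀ᶠ x in 𝓝 (1 : E), c.proj x = 1 → x = 1 := by
  have h : {(1 : ℤˣ)} ∈ (𝓝 (c.incl 1)).comap c.incl := by
    rw [← c.isEmbedding_incl.nhds_eq_comap]
    exact mem_nhds_discrete.2 rfl
  obtain ⟨O, hO, hO_one⟩ := h
  rw [map_one] at hO
  filter_upwards [hO] with x hxO hx
  obtain ⟨e, rfl⟩ : x ∈ c.incl.range := c.exact ▸ MonoidHom.mem_ker.2 hx
  rw [Set.mem_singleton_iff.1 (hO_one hxO), map_one]

theorem eventually_conj_section_eq [IsTopologicalGroup G] {s : G → E} (hs : ContinuousAt s 1)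
    (hs_one : s 1 = 1) (hsec : ∀ᶠ x in 𝓝 1, c.proj (s x) = x) (g : E) :
    ∀ᶠ x in 𝓝 1, g * s x * g⁻¹ = s (c.proj g * x * (c.proj g)⁻¹) := by
  have hconj : Filter.Tendsto (fun x => c.proj g * x * (c.proj g)⁻¹) (𝓝 1) (𝓝 1) :=
    (Continuous.tendsto' (by fun_prop) _ _ (by rw [mul_one, mul_inv_cancel]))
  let f : G → E := fun x => g * s x * g⁻¹ * (s (c.proj g * x * (c.proj g)⁻¹))⁻¹
  have hf : Filter.Tendsto f (𝓝 1) (𝓝 1) := by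
    rw [ContinuousAt, hs_one] at hs
    simpa using ((hs.const_mul g).mul_const g⁻¹).mul (hs.comp hconj).inv
  filter_upwards [hf.eventually c.eventually_eq_one_of_proj_eq_one, hsec,
    hconj.eventually hsec] with x hfx hx hx'
  refine mul_inv_eq_one.1 (hfx ?_)
  rw [map_mul, map_mul, map_mul, map_inv, map_inv, hx, hx', mul_inv_cancel]

theorem normal_of_hasLocalSectionIn [IsTopologicalGroup G] {S : Subgroup E} {U : Subgroup G}
    [U.Normal] (hU : HasOddNormalBasis U) (hS : IsLift c.proj.toMonoidHom S U)
    (hsec : HasLocalSectionIn c.proj.toMonoidHom S) : S.Normal := by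
  obtain ⟨s, hs, hsS⟩ := hsec
  have hs_one : s 1 = 1 := hS.eq_one hsS.self_of_nhds.1 hsS.self_of_nhds.2
  refine ⟨fun x hx g => ?_⟩
  have hconj : ∀ᶠ y in 𝓝 (1 : G), c.proj g * y * (c.proj g)⁻¹ ∈ {y | s y ∈ S} :=
    (Continuous.tendsto' (by fun_prop) _ _ (by rw [mul_one, mul_inv_cancel])).eventually
      (hsS.mono fun y hy => hy.1)
  obtain ⟨V, -, hVW, hVn, -, hodd⟩ := hU _ <| Filter.inter_mem hsS <| Filter.inter_mem hconj <|
    c.eventually_conj_section_eq hs hs_one (hsS.mono fun y hy => hy.2) g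
  have hm : (V.relIndex U).Coprime (Nat.card c.proj.toMonoidHom.ker) := by
    rwa [c.natCard_ker_proj, Nat.coprime_two_right]
  refine hS.conj_mem_of_conj_pow_mem inferInstance c.ker_proj_le_center hm hx ?_
  have hxV : c.proj.toMonoidHom (x ^ V.relIndex U) ∈ V := by
    rw [map_pow]
    exact Subgroup.pow_index_mem (V.subgroupOf U) ⟨_, hS.le_comap hx⟩
  obtain ⟨⟨hyS, hy⟩, hy_conj, hy_eq⟩ := hVW hxV
  have hsx : s (c.proj.toMonoidHom (x ^ V.relIndex U)) = x ^ V.relIndex U :=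
    mul_inv_eq_one.1 <| hS.eq_one (mul_mem hyS (inv_mem (pow_mem hx _)))
      (by rw [map_mul, map_inv, hy, mul_inv_cancel])
  rw [Set.mem_ofPred_eq, hsx] at hy_eq
  rwa [hy_eq]

theorem exists_isLift_of_small : ∃ W ∈ 𝓝 (1 : G), ∀ V : Subgroup G, (V : Set G) ∈ 𝓝 1 →
    (V : Set G) ⊆ W →
      ∃ T, IsLift c.proj.toMonoidHom T V ∧ HasLocalSectionIn c.proj.toMonoidHom T := by
  obtain ⟨W, hW, s, hs, hps, hmul⟩ := c.locally_split
  refine ⟨W, hW, fun V hV hVW => ?_⟩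
  let sV : V →* E := MonoidHom.mk' (fun v => s v) fun a b =>
    hmul _ (hVW a.2) _ (hVW b.2) (hVW (a * b).2)
  have hsV : ∀ v : V, c.proj (sV v) = v := fun v => hps _ (hVW v.2)
  refine ⟨sV.range, ⟨?_, Subgroup.disjoint_def.2 ?_⟩, s, hs.continuousAt hW, ?_⟩
  · have hcomp : c.proj.toMonoidHom.comp sV = V.subtype := MonoidHom.ext hsV
    rw [MonoidHom.map_range, hcomp, Subgroup.range_subtype]
  · rintro _ ⟨v, rfl⟩ hv
    rw [Subtype.ext ((hsV v).symm.trans hv : (v : G) = (1 : V)), map_one]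
  · filter_upwards [hV] with x hx
    exact ⟨⟨⟨x, hx⟩, rfl⟩, hsV ⟨x, hx⟩⟩

theorem exists_normal_isLift [IsTopologicalGroup G] {U : Subgroup G} [U.Normal]
    (hU : HasOddNormalBasis U) : ∃ S : Subgroup E, S.Normal ∧
      IsLift c.proj.toMonoidHom S U ∧ HasLocalSectionIn c.proj.toMonoidHom S := by
  obtain ⟨W, hW, hlift⟩ := c.exists_isLift_of_small
  obtain ⟨V, hV, hVW, hVn, hVU, hodd⟩ := hU W hW
  obtain ⟨T, hT, s, hs, hsT⟩ := hlift V hV hVW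
  have : T.Normal := c.normal_of_hasLocalSectionIn (hU.of_le hV hVU) hT ⟨s, hs, hsT⟩
  obtain ⟨S, hTS, hS⟩ := hT.exists_ge hVU
    (MonoidHom.range_eq_top.2 c.proj_surjective ▸ le_top)
    (by rwa [c.natCard_ker_proj, Nat.coprime_two_left])
  have hsS : HasLocalSectionIn c.proj.toMonoidHom S :=
    ⟨s, hs, hsT.mono fun x hx => ⟨hTS hx.1, hx.2⟩⟩
  exact ⟨S, c.normal_of_hasLocalSectionIn hU hS hsS, hS, hsS⟩

section Complex

/-- The canonical map from a 2-fold cover to the `ℂˣ`-cover obtained from it. -/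
def toComplex : E →* c.ComplexTotal :=
  (QuotientGroup.mk' c.antidiagonal).comp (MonoidHom.inl E ℂˣ)

/-- The inclusion of the kernel in the `ℂˣ`-cover obtained from a 2-fold cover. -/
def complexIncl : ℂˣ →* c.ComplexTotal :=
  (QuotientGroup.mk' c.antidiagonal).comp (MonoidHom.inr E ℂˣ)

theorem continuous_toComplex : Continuous c.toComplex :=
  continuous_quot_mk.comp (Continuous.prodMk_left 1)

theorem complexProj_comp_toComplex : c.complexProj.comp c.toComplex = c.proj.toMonoidHom := rfl

theorem complexProj_surjective : Function.Surjective c.complexProj := fun g =>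
  let ⟨x, hx⟩ := c.proj_surjective g
  ⟨c.toComplex x, hx⟩

theorem exists_toComplex_mul_complexIncl (t : c.ComplexTotal) :
    ∃ x z, c.toComplex x * c.complexIncl z = t := by
  obtain ⟨⟨x, z⟩, rfl⟩ := QuotientGroup.mk_surjective t
  exact ⟨x, z, congrArg QuotientGroup.mk (Prod.ext (mul_one x) (one_mul z))⟩

theorem toComplex_incl_neg_one : c.toComplex (c.incl (-1)) = c.complexIncl (-1) :=
  QuotientGroup.eq.2 ⟨-1, by simp [MonoidHom.inl, MonoidHom.inr]⟩

theorem commute_complexIncl (z : ℂˣ) (t : c.ComplexTotal) : Commute (c.complexIncl z) t := by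
  obtain ⟨⟨x, y⟩, rfl⟩ := QuotientGroup.mk_surjective t
  exact congrArg QuotientGroup.mk
    (Prod.ext ((one_mul x).trans (mul_one x).symm) (mul_comm z y))

theorem range_complexIncl : c.complexIncl.range = c.complexProj.ker := by
  refine le_antisymm ?_ fun t ht => ?_
  · rintro _ ⟨z, rfl⟩
    exact map_one c.proj
  · obtain ⟨x, z, rfl⟩ := c.exists_toComplex_mul_complexIncl t
    have hz : c.complexProj (c.complexIncl z) = 1 := map_one c.proj
    rw [MonoidHom.mem_ker, map_mul, hz, mul_one] at ht
    obtain ⟨e, rfl⟩ : x ∈ c.incl.range := c.exact ▸ ht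
    rcases Int.units_eq_one_or e with rfl | rfl
    · exact ⟨z, by rw [map_one, map_one, one_mul]⟩
    · exact ⟨-1 * z, by rw [map_mul, c.toComplex_incl_neg_one]⟩

theorem ker_complexProj_le_center : c.complexProj.ker ≤ Subgroup.center c.ComplexTotal := by
  rw [← c.range_complexIncl]
  rintro _ ⟨z, rfl⟩
  exact Subgroup.mem_center_iff.2 fun t => (c.commute_complexIncl z t).symm

theorem exists_pow_eq_of_mem_ker_complexProj {n : ℕ} (hn : n ≠ 0) {t : c.ComplexTotal}
    (ht : t ∈ c.complexProj.ker) : ∃ r ∈ c.complexProj.ker, r ^ n = t := by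
  rw [← c.range_complexIncl] at ht ⊢
  obtain ⟨z, rfl⟩ := ht
  obtain ⟨d, hd⟩ := IsAlgClosed.exists_pow_nat_eq (z : ℂ) (Nat.pos_of_ne_zero hn)
  have hd_unit : IsUnit d := (isUnit_pow_iff hn).1 (hd ▸ z.isUnit)
  refine ⟨_, ⟨hd_unit.unit, rfl⟩, ?_⟩
  rw [← map_pow]
  exact congrArg c.complexIncl (Units.ext hd)

variable {c} in
theorem isLift_map_toComplex {S : Subgroup E} {U : Subgroup G}
    (hS : IsLift c.proj.toMonoidHom S U) : IsLift c.complexProj (S.map c.toComplex) U := by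
  refine ⟨by rw [Subgroup.map_map, c.complexProj_comp_toComplex, hS.map_eq],
    Subgroup.disjoint_def.2 ?_⟩
  rintro _ ⟨x, hx, rfl⟩ hpx
  rw [hS.eq_one hx hpx, map_one]

theorem normal_map_toComplex (S : Subgroup E) [S.Normal] : (S.map c.toComplex).Normal := by
  refine ⟨?_⟩
  rintro _ ⟨x, hx, rfl⟩ t
  obtain ⟨y, z, rfl⟩ := c.exists_toComplex_mul_complexIncl t
  refine ⟨y * x * y⁻¹, Subgroup.Normal.conj_mem inferInstance x hx y, ?_⟩
  rw [mul_assoc (c.toComplex y), (c.commute_complexIncl z _).eq, mul_inv_rev, map_mul, map_mul,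
    map_inv]
  group

theorem hasLocalSectionIn_map_toComplex {S : Subgroup E}
    (hS : HasLocalSectionIn c.proj.toMonoidHom S) :
    HasLocalSectionIn c.complexProj (S.map c.toComplex) := by
  obtain ⟨s, hs, hsS⟩ := hS
  exact ⟨c.toComplex ∘ s, c.continuous_toComplex.continuousAt.comp hs,
    hsS.mono fun x hx => ⟨Subgroup.mem_map_of_mem _ hx.1, hx.2⟩⟩

theorem extensionSplitsOver_complexProj {A : Subgroup G}
    (h : ExtensionSplitsOver c.proj.toMonoidHom A) : ExtensionSplitsOver c.complexProj A := by
  obtain ⟨s, hs⟩ := h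
  exact ⟨⟨c.toComplex.comp s.toMonoidHom, c.continuous_toComplex.comp s.continuous_toFun⟩, hs⟩

/-- The extension is pushed down to `G ⧸ U` by dividing out the lift of the pro-odd group `U`. -/
theorem extensionSplits_complexProj [IsTopologicalGroup G] {U : Subgroup G} [U.Normal]
    (hU : HasOddNormalBasis U) {z w : G} {q : ℕ} (hq : 1 < q)
    (hzw : (w * z * w⁻¹ : G ⧸ U) = z ^ q) (hz : q ^ 2 - 1 ∣ orderOf (z : G ⧸ U))
    (hw : ∀ k : ℤ, (w ^ k : G ⧸ U) ∈ Subgroup.zpowers (z : G ⧸ U) → k = 0)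
    (htop : Subgroup.zpowers (w : G ⧸ U) ⊔ Subgroup.zpowers (z : G ⧸ U) = ⊤)
    {A : Subgroup G} (hA : ExtensionSplitsOver c.complexProj A) (hzA : z ∈ A) (hwA : w ^ 2 ∈ A)
    (hcomm : Commute z (w ^ 2)) : ExtensionSplits c.complexProj := by
  obtain ⟨S₀, hS₀n, hS₀, hsec₀⟩ := c.exists_normal_isLift hU
  set S := S₀.map c.toComplex
  have hSn : S.Normal := c.normal_map_toComplex S₀
  have hS : IsLift c.complexProj S U := isLift_map_toComplex hS₀
  let π := QuotientGroup.mk' S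
  let p : c.ComplexTotal ⧸ S →* G ⧸ U := QuotientGroup.map S U c.complexProj hS.le_comap
  have hp : Function.Surjective p :=
    QuotientGroup.map_surjective_of_surjective _ _ _
      ((QuotientGroup.mk'_surjective U).comp c.complexProj_surjective) _
  have hcenter : p.ker ≤ Subgroup.center (c.ComplexTotal ⧸ S) := by
    rw [hS.ker_quotientMap]
    rintro _ ⟨t, ht, rfl⟩
    refine Subgroup.mem_center_iff.2 fun x => ?_
    obtain ⟨x, rfl⟩ := QuotientGroup.mk'_surjective S x
    rw [← map_mul, ← map_mul, Subgroup.mem_center_iff.1 (c.ker_complexProj_le_center ht) x]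
  have hdiv : ∀ n ≠ 0, ∀ x ∈ p.ker, ∃ y ∈ p.ker, y ^ n = x := by
    rw [hS.ker_quotientMap]
    rintro n hn _ ⟨t, ht, rfl⟩
    obtain ⟨r, hr, rfl⟩ := c.exists_pow_eq_of_mem_ker_complexProj hn ht
    exact ⟨π r, Subgroup.mem_map_of_mem π hr, (map_pow π r n).symm⟩
  obtain ⟨r, hr⟩ := hA
  have hcommA : Commute (⟨z, hzA⟩ : A) ⟨w ^ 2, hwA⟩ := Subtype.ext hcomm
  obtain ⟨H, hH⟩ := exists_isLift_top_of_commute hp hcenter hdiv hq hzw hz hw htop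
    (a₀ := π (r ⟨z, hzA⟩)) (b₀ := π (r ⟨w ^ 2, hwA⟩))
    (congrArg QuotientGroup.mk (hr _)) (congrArg QuotientGroup.mk (hr _))
    ((hcommA.map r).map π)
  obtain ⟨s, hs, hsS⟩ := c.hasLocalSectionIn_map_toComplex hsec₀
  have hSH : S ≤ H.comap π := by simpa only [π, QuotientGroup.ker_mk'] using π.ker_le_comap H
  exact (hS.comap_mk' hH).extensionSplits ⟨s, hs, hsS.mono fun x hx => ⟨hSH hx.1, hx.2⟩⟩

end Complex

end TwoFoldCover

section LocalRing

open IsLocalRing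

theorem exists_isUnit_or_irreducible_mul_sq_eq (R : Type*) {K : Type*} [CommRing R] [IsDomain R]
    [IsDiscreteValuationRing R] [Field K] [Algebra R K] [IsFractionRing R K] {d : K}
    (hd : d ≠ 0) :
    ∃ t ≠ 0, ∃ r : R, (IsUnit r ∨ Irreducible r) ∧ d * t ^ 2 = algebraMap R K r := by
  obtain ⟨ϖ, hϖ⟩ := IsDiscreteValuationRing.exists_irreducible R
  have hϖK : algebraMap R K ϖ ≠ 0 := by simpa using hϖ.ne_zero
  obtain ⟨n, u, rfl⟩ := IsDiscreteValuationRing.exists_units_eq_smul_zpow_of_irreducible hϖ hd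
  have hsq (k : ℤ) : algebraMap R K ϖ ^ (2 * k) * (algebraMap R K ϖ ^ (-k)) ^ 2 = 1 := by
    rw [zpow_mul', zpow_ofNat, ← mul_pow, ← zpow_add₀ hϖK, add_neg_cancel, zpow_zero, one_pow]
  rcases Int.even_or_odd' n with ⟨k, rfl | rfl⟩
  · refine ⟨algebraMap R K ϖ ^ (-k), zpow_ne_zero _ hϖK, u, Or.inl u.isUnit, ?_⟩
    rw [Units.smul_def, Algebra.smul_def, mul_assoc, hsq, mul_one]
  · refine ⟨algebraMap R K ϖ ^ (-k), zpow_ne_zero _ hϖK, u * ϖ,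
      Or.inr ((irreducible_units_mul u).2 hϖ), ?_⟩
    rw [Units.smul_def, Algebra.smul_def, zpow_add_one₀ hϖK, map_mul]
    linear_combination algebraMap R K u * algebraMap R K ϖ * hsq k

variable {R : Type*} [CommRing R] [HenselianLocalRing R]

theorem isSquare_of_isSquare_residue (h2 : IsUnit (2 : R)) {d : R} (hd : IsUnit d)
    (h : IsSquare (residue R d)) : IsSquare d := by
  obtain ⟨y, hy⟩ := h
  obtain ⟨a₀, rfl⟩ := residue_surjective y
  have ha₀ : residue R a₀ ≠ 0 := by
    rintro ha₀
    rw [ha₀, mul_zero] at hy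
    exact (residue_ne_zero_iff_isUnit d).2 hd hy
  obtain ⟨a, ha, -⟩ := HenselianLocalRing.is_henselian (Polynomial.X ^ 2 - Polynomial.C d)
    (Polynomial.monic_X_pow_sub_C d two_ne_zero) a₀
    (by rw [← residue_eq_zero_iff]; simp [hy, pow_two])
    (by simpa [one_add_one_eq_two] using! ⟨h2, (residue_ne_zero_iff_isUnit a₀).1 ha₀⟩)
  exact ⟨a, by simpa [pow_two, sub_eq_zero, eq_comm] using ha⟩

theorem exists_sq_eq_mul_sq_add [Finite (ResidueField R)] (h2 : IsUnit (2 : R)) {ε π : R}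
    (hε : IsUnit ε) (hπ : IsUnit π) : ∃ a b : R, a ^ 2 = ε * b ^ 2 + π := by
  have := Fintype.ofFinite (ResidueField R)
  have hε' := (residue_ne_zero_iff_isUnit ε).2 hε
  have hcard : Fintype.card (ResidueField R) % 2 = 1 := by
    refine FiniteField.odd_card_of_char_ne_two fun hchar => ?_
    refine (residue_ne_zero_iff_isUnit 2).2 h2 ?_
    rw [map_ofNat, ← Nat.cast_ofNat, ← hchar, ringChar.Nat.cast_ringChar]
  obtain ⟨x, y, hxy⟩ : ∃ x y : ResidueField R, x ^ 2 = residue R ε * y ^ 2 + residue R π := by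
    obtain ⟨x, y, hxy⟩ := FiniteField.exists_root_sum_quadratic (f := Polynomial.X ^ 2)
      (g := Polynomial.C (-residue R ε) * Polynomial.X ^ 2 + Polynomial.C 0 * Polynomial.X +
        Polynomial.C (-residue R π))
      (by simp) (Polynomial.degree_quadratic (neg_ne_zero.2 hε')) hcard
    simp only [Polynomial.eval_pow, Polynomial.eval_X, Polynomial.eval_add, Polynomial.eval_mul,
      Polynomial.eval_C, zero_mul, add_zero] at hxy
    exact ⟨x, y, by linear_combination hxy⟩
  obtain ⟨b, rfl⟩ := residue_surjective y
  by_cases hx : IsUnit (ε * b ^ 2 + π)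
  · obtain ⟨a, ha⟩ := isSquare_of_isSquare_residue h2 hx
      ⟨x, by rw [map_add, map_mul, map_pow, ← hxy, pow_two]⟩
    exact ⟨a, b, by rw [ha, pow_two]⟩
  · obtain ⟨ε, rfl⟩ := hε
    have hres : residue R ε * residue R b ^ 2 + residue R π = 0 := by
      simpa using (residue_eq_zero_iff (ε * b ^ 2 + π)).2 hx
    obtain ⟨c, hc⟩ := isSquare_of_isSquare_residue h2 (d := -π * (↑ε⁻¹ : R))
      (hπ.neg.mul ε⁻¹.isUnit) ⟨residue R b, by
        have hinv : residue R ε * residue R (↑ε⁻¹ : R) = 1 := by rw [← map_mul, ε.mul_inv, map_one]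
        rw [map_mul, map_neg]
        linear_combination -residue R (↑ε⁻¹ : R) * hres + residue R b ^ 2 * hinv⟩
    exact ⟨0, c, by linear_combination (ε : R) * hc + π * ε.mul_inv⟩

end LocalRing

section LocalField

open ValuativeRel IsLocalRing

variable {F : Type*} [Field F] [ValuativeRel F]

theorem residue_eq_zero_iff_valuation_lt_one (x : 𝒪[F]) :
    residue 𝒪[F] x = 0 ↔ valuation F x < 1 := by
  rw [residue_eq_zero_iff, mem_maximalIdeal, mem_nonunits_iff,
    Valuation.Integer.not_isUnit_iff_valuation_lt_one]

theorem isUnit_two_integer (hF : ringChar 𝓀[F] ≠ 2) : IsUnit (2 : 𝒪[F]) :=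
  (residue_ne_zero_iff_isUnit 2).1 (by rw [map_ofNat]; exact Ring.two_ne_zero hF)

theorem valuation_two (hF : ringChar 𝓀[F] ≠ 2) : valuation F 2 = 1 :=
  (Valuation.integer.integers (valuation F)).one_of_isUnit (isUnit_two_integer hF)

theorem two_ne_zero_of_ringChar_residueField_ne_two (hF : ringChar 𝓀[F] ≠ 2) : (2 : F) ≠ 0 := by
  rw [← (valuation F).ne_zero_iff, valuation_two hF]
  exact one_ne_zero

theorem valuation_lt_one_of_irreducible {π : 𝒪[F]} (hπ : Irreducible π) : valuation F π < 1 :=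
  Valuation.Integer.not_isUnit_iff_valuation_lt_one.1 hπ.not_isUnit

theorem valuation_ne_zero_of_irreducible {π : 𝒪[F]} (hπ : Irreducible π) : valuation F π ≠ 0 :=
  (Valuation.ne_zero_iff _).2 (by simpa using hπ.ne_zero)

variable [TopologicalSpace F] [IsNonarchimedeanLocalField F]

variable (F) in
theorem henselianLocalRing_integer : HenselianLocalRing 𝒪[F] where
  is_henselian f hf a₀ ha₀ hder := by
    let := IsTopologicalAddGroup.rightUniformSpace F
    have := isUniformAddGroup_of_addCommGroup (G := F)
    exact HenselianRing.is_henselian (I := 𝓂[F]) f hf a₀ ha₀ (hder.map _)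

theorem exists_valuation_eq_zpow {π : 𝒪[F]} (hπ : Irreducible π) {x : F} (hx : x ≠ 0) :
    ∃ n : ℤ, valuation F x = valuation F π ^ n := by
  obtain ⟨n, u, rfl⟩ := IsDiscreteValuationRing.exists_units_eq_smul_zpow_of_irreducible hπ hx
  refine ⟨n, ?_⟩
  have hu : valuation F ((u : 𝒪[F]) : F) = 1 :=
    (Valuation.integer.integers (valuation F)).one_of_isUnit u.isUnit
  rw [Units.smul_def, Algebra.smul_def, map_mul, map_zpow₀]
  exact (congrArg (· * _) hu).trans (one_mul _)

theorem valuation_le_of_irreducible {π : 𝒪[F]} (hπ : Irreducible π) {x : F}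
    (hx : valuation F x < 1) : valuation F x ≤ valuation F π := by
  have hx' : (⟨x, hx.le⟩ : 𝒪[F]) ∈ 𝓂[F] :=
    (mem_maximalIdeal _).2 (Valuation.Integer.not_isUnit_iff_valuation_lt_one.2 hx)
  rw [hπ.maximalIdeal_eq, Ideal.mem_span_singleton] at hx'
  exact (Valuation.integer.integers (valuation F)).le_of_dvd hx'

theorem valuation_ne_valuation_sq_of_irreducible {π : 𝒪[F]} (hπ : Irreducible π) (x : F) :
    valuation F π ≠ valuation F x ^ 2 := fun h => by
  have hx : valuation F x < 1 := by
    rw [← pow_lt_one_iff two_ne_zero, ← h]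
    exact valuation_lt_one_of_irreducible hπ
  have hle : valuation F π ≤ valuation F π ^ 2 :=
    h.trans_le (pow_le_pow_left' (valuation_le_of_irreducible hπ hx) 2)
  exact hle.not_gt (pow_lt_self_of_lt_one₀ (zero_lt_iff.2 (valuation_ne_zero_of_irreducible hπ))
    (valuation_lt_one_of_irreducible hπ) one_lt_two)

end LocalField

section QuadraticExtension

section

variable {F M : Type*} [Field F] [Field M] [Algebra F M]

theorem exists_sq_eq_algebraMap_of_finrank_eq_two (h2 : (2 : F) ≠ 0)
    (hM : Module.finrank F M = 2) : ∃ (α : M) (d : F), α ^ 2 = algebraMap F M d ∧ ¬ IsSquare d := by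
  obtain ⟨x, hx⟩ : ∃ x : M, ∀ a, algebraMap F M a ≠ x := by
    by_contra! h
    have hbot : (⊥ : Subalgebra F M) = ⊤ := eq_top_iff.2 fun x _ => Algebra.mem_bot.2 (h x)
    rw [Subalgebra.bot_eq_top_iff_finrank_eq_one, hM] at hbot
    exact absurd hbot (by norm_num)
  have : FiniteDimensional F M := FiniteDimensional.of_finrank_pos (by rw [hM]; norm_num)
  have hli : LinearIndependent F ![1, x] :=
    (LinearIndependent.pair_iff' one_ne_zero).2 fun a ha =>
      hx a (by rw [Algebra.algebraMap_eq_smul_one, ha])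
  have hmem : x ^ 2 ∈ Submodule.span F (Set.range ![1, x]) :=
    hli.span_eq_top_of_card_eq_finrank' (by rw [hM]; rfl) ▸ Submodule.mem_top
  rw [Matrix.range_cons_cons_empty, Submodule.mem_span_pair] at hmem
  obtain ⟨c, b, hcb⟩ := hmem
  rw [← Algebra.algebraMap_eq_smul_one, Algebra.smul_def] at hcb
  have hb : algebraMap F M b = 2 * algebraMap F M (b / 2) := by
    rw [← map_ofNat (algebraMap F M) 2, ← map_mul, mul_div_cancel₀ _ h2]
  have hsq : (x - algebraMap F M (b / 2)) ^ 2 = algebraMap F M (c + (b / 2) ^ 2) := by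
    rw [map_add, map_pow]
    linear_combination -hcb + x * hb
  refine ⟨x - algebraMap F M (b / 2), c + (b / 2) ^ 2, hsq, ?_⟩
  rintro ⟨r, hr⟩
  rw [hr, ← pow_two, map_pow, sq_eq_sq_iff_eq_or_eq_neg] at hsq
  rcases hsq with h | h
  · exact hx (r + b / 2) (by rw [map_add, ← h, sub_add_cancel])
  · exact hx (-r + b / 2) (by rw [map_add, map_neg, ← h, sub_add_cancel])

theorem ne_algebraMap_of_sq_eq {α : M} {d : F} (hα : α ^ 2 = algebraMap F M d)
    (hd : ¬ IsSquare d) (a : F) : algebraMap F M a ≠ α := by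
  rintro rfl
  rw [← map_pow] at hα
  exact hd ⟨a, by rw [← pow_two, (algebraMap F M).injective hα]⟩

theorem nonempty_algEquiv_quadraticAlgebra (hM : Module.finrank F M = 2) {α : M} {d : F}
    (hα : α ^ 2 = algebraMap F M d) (hd : ¬ IsSquare d) :
    Nonempty (QuadraticAlgebra F d 0 ≃ₐ[F] M) := by
  have : FiniteDimensional F M := FiniteDimensional.of_finrank_pos (by rw [hM]; norm_num)
  let f : QuadraticAlgebra F d 0 →ₐ[F] M := QuadraticAlgebra.lift
    ⟨α, by rw [← pow_two, hα, Algebra.algebraMap_eq_smul_one, zero_smul, add_zero]⟩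
  have hf : Function.Injective f := (injective_iff_map_eq_zero f).2 fun x hx => by
    have hx' : x.re • (1 : M) + x.im • α = 0 := hx
    have hli : LinearIndependent F ![1, α] :=
      (LinearIndependent.pair_iff' one_ne_zero).2 fun a ha =>
        ne_algebraMap_of_sq_eq hα hd a (by rw [Algebra.algebraMap_eq_smul_one, ha])
    obtain ⟨hre, him⟩ := LinearIndependent.pair_iff.1 hli _ _ hx'
    exact QuadraticAlgebra.ext hre him
  exact ⟨AlgEquiv.ofBijective f ⟨hf, (LinearMap.injective_iff_surjective_of_finrank_eq_finrank
    (f := f.toLinearMap) (by rw [QuadraticAlgebra.finrank_eq_two, hM])).1 hf⟩⟩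

theorem isSeparable_of_finrank_eq_two (h2 : (2 : F) ≠ 0) (hM : Module.finrank F M = 2) :
    Algebra.IsSeparable F M := by
  obtain ⟨α, d, hα, hd⟩ := exists_sq_eq_algebraMap_of_finrank_eq_two h2 hM
  have := IntermediateField.isSimpleOrder_of_finrank_prime F M (by rw [hM]; exact Nat.prime_two)
  have htop : IntermediateField.adjoin F {α} = ⊤ := by
    refine (eq_bot_or_eq_top _).resolve_left fun hbot => ?_
    obtain ⟨a, ha⟩ :=
      IntermediateField.mem_bot.1 (IntermediateField.adjoin_simple_eq_bot_iff.1 hbot)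
    exact ne_algebraMap_of_sq_eq hα hd a ha
  have hd0 : d ≠ 0 := fun h => hd (h ▸ IsSquare.zero)
  have hsep : IsSeparable F α :=
    (Polynomial.separable_X_pow_sub_C d (n := 2) (by exact_mod_cast h2) hd0).of_dvd
      (minpoly.dvd F α (by simp [hα]))
  rw [← IntermediateField.isSeparable_adjoin_simple_iff_isSeparable, htop] at hsep
  exact AlgEquiv.Algebra.isSeparable IntermediateField.topEquiv

end

theorem not_isSquare_algebraMap_of_irreducible {R S : Type*} [CommRing R] [IsDomain R]
    [IsDiscreteValuationRing R] [CommRing S] [IsDomain S] [Algebra R S] [Module.Finite R S]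
    [FaithfulSMul R S] [Algebra.FormallyUnramified R S] {π : R} (hπ : Irreducible π) :
    ¬ IsSquare (algebraMap R S π) := by
  rintro ⟨α, hα⟩
  have hmap : (IsLocalRing.maximalIdeal R).map (algebraMap R S) =
      Ideal.span {algebraMap R S π} := by
    rw [hπ.maximalIdeal_eq, Ideal.map_span, Set.image_singleton]
  have hrad : (Ideal.span {algebraMap R S π}).IsRadical :=
    hmap ▸ Algebra.FormallyUnramified.isRadical_map_isMaximal R S (IsLocalRing.maximalIdeal R)
  have hα_mem : α ∈ Ideal.span {algebraMap R S π} :=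
    hrad ⟨2, by rw [pow_two, ← hα]; exact Ideal.mem_span_singleton_self _⟩
  obtain ⟨β, rfl⟩ := Ideal.mem_span_singleton.1 hα_mem
  have hπ0 : algebraMap R S π ≠ 0 := by simpa using hπ.ne_zero
  have hunit : algebraMap R S π * β ^ 2 = 1 :=
    mul_left_cancel₀ hπ0 (by linear_combination -hα)
  exact hπ.not_isUnit (isUnit_of_map_unit (algebraMap R S) π (.of_mul_eq_one _ hunit))

open ValuativeRel IsLocalRing

theorem IsUnramifiedExtension.exists_algEquiv_quadraticAlgebra {F : Type*} [Field F]
    [ValuativeRel F] [TopologicalSpace F] [IsNonarchimedeanLocalField F] {M : Type*} [Field M]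
    [Algebra F M] (hF : ringChar 𝓀[F] ≠ 2) (hM : Module.finrank F M = 2)
    (hM' : IsUnramifiedExtension F M) :
    ∃ ε : 𝒪[F], ¬ IsSquare (residue 𝒪[F] ε) ∧
      Nonempty (QuadraticAlgebra F (ε : F) 0 ≃ₐ[F] M) := by
  have h2 := two_ne_zero_of_ringChar_residueField_ne_two hF
  have : FiniteDimensional F M := FiniteDimensional.of_finrank_pos (by rw [hM]; norm_num)
  have := isSeparable_of_finrank_eq_two h2 hM
  have : Module.Finite 𝒪[F] (integralClosure 𝒪[F] M) :=
    IsIntegralClosure.finite 𝒪[F] F M (integralClosure 𝒪[F] M)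
  have : Algebra.FormallyUnramified 𝒪[F] (integralClosure 𝒪[F] M) := hM'
  have : FaithfulSMul 𝒪[F] (integralClosure 𝒪[F] M) := by
    rw [faithfulSMul_iff_algebraMap_injective]
    exact .of_comp (f := Subtype.val) ((algebraMap F M).injective.comp Subtype.val_injective)
  obtain ⟨α, d, hα, hd⟩ := exists_sq_eq_algebraMap_of_finrank_eq_two h2 hM
  obtain ⟨t, ht, ε, hε, hdt⟩ :=
    exists_isUnit_or_irreducible_mul_sq_eq 𝒪[F] (d := d) fun h => hd (h ▸ IsSquare.zero)
  have hεF : ¬ IsSquare (ε : F) := fun ⟨r, hr⟩ =>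
    hd ⟨r / t, by rw [div_mul_div_comm, ← hr, ← pow_two, eq_div_iff (pow_ne_zero 2 ht), hdt]; rfl⟩
  have hαt : (α * algebraMap F M t) ^ 2 = algebraMap F M ε := by
    rw [mul_pow, hα, ← map_pow, ← map_mul, hdt]; rfl
  refine ⟨ε, fun hsq => ?_, nonempty_algEquiv_quadraticAlgebra hM hαt hεF⟩
  rcases hε with hε | hε
  · have := henselianLocalRing_integer F
    exact hεF ((isSquare_of_isSquare_residue (isUnit_two_integer hF) hε hsq).map 𝒪[F].subtype)
  · have hint : IsIntegral 𝒪[F] (α * algebraMap F M t) :=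
      .of_pow two_pos (hαt ▸ isIntegral_algebraMap (x := ε))
    exact not_isSquare_algebraMap_of_irreducible hε
      ⟨(⟨_, hint⟩ : integralClosure 𝒪[F] M), Subtype.ext (hαt.symm.trans (pow_two _))⟩

end QuadraticExtension

section Quaternion

section

variable {F D : Type*} [Field F] [DivisionRing D] [Algebra F D]

section

variable {L : Type*} [Field L] [Algebra F L] (φ : L →ₐ[F] D) {j : D}

include φ in
theorem eq_zero_of_add_mul_eq_zero (hj : j ∉ φ.range) {m n : L} (h : φ m + φ n * j = 0) :
    m = 0 ∧ n = 0 := by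
  have hn : n = 0 := by
    by_contra hn
    refine hj ⟨n⁻¹ * -m, ?_⟩
    change φ _ = j
    rw [map_mul, map_neg, ← eq_neg_of_add_eq_zero_right h, ← mul_assoc, ← map_mul,
      inv_mul_cancel₀ hn, map_one, one_mul]
  rw [hn, map_zero, zero_mul, add_zero, map_eq_zero] at h
  exact ⟨h, hn⟩

theorem exists_add_mul_eq [FiniteDimensional F D]
    (hD : Module.finrank F D = 2 * Module.finrank F L) (hj : j ∉ φ.range) (x : D) :
    ∃ m n, φ m + φ n * j = x := by
  have : FiniteDimensional F L := .of_injective φ.toLinearMap φ.toRingHom.injective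
  let f : L × L →ₗ[F] D :=
    φ.toLinearMap.coprod (LinearMap.mulRight F j ∘ₗ φ.toLinearMap)
  have hf : Function.Injective f := (injective_iff_map_eq_zero f).2 fun p hp => by
    obtain ⟨hm, hn⟩ := eq_zero_of_add_mul_eq_zero φ hj hp
    exact Prod.ext hm hn
  obtain ⟨⟨m, n⟩, h⟩ := (LinearMap.injective_iff_surjective_of_finrank_eq_finrank
    (by rw [Module.finrank_prod, hD, two_mul])).1 hf x
  exact ⟨m, n, h⟩

end

theorem exists_anticommute_of_notMem_center {α : D} {d : F} (hα : α ^ 2 = algebraMap F D d)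
    (hα_center : α ∉ Subalgebra.center F D) : ∃ j ≠ 0, j * α = -(α * j) := by
  simp only [Subalgebra.mem_center_iff, not_forall] at hα_center
  obtain ⟨x, hx⟩ := hα_center
  refine ⟨α * x - x * α, sub_ne_zero.2 (Ne.symm hx), ?_⟩
  have hcomm : α * α * x = x * (α * α) := by
    rw [← pow_two, hα, Algebra.commutes]
  simp only [sub_mul, mul_sub, ← mul_assoc, hcomm]
  abel

variable {a : F} {φ : QuadraticAlgebra F a 0 →ₐ[F] D} {j : D}

variable (φ) in
theorem map_quadraticAlgebra (m : QuadraticAlgebra F a 0) :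
    φ m = algebraMap F D m.re + m.im • φ QuadraticAlgebra.omega := by
  obtain ⟨x, y⟩ := m
  rw [QuadraticAlgebra.mk_eq_add_smul_omega, map_add, map_smul, AlgHom.commutes,
    ← QuadraticAlgebra.mk_eq_add_smul_omega]

variable (φ) in
theorem map_omega_sq : φ QuadraticAlgebra.omega ^ 2 = algebraMap F D a := by
  rw [← map_pow, pow_two, QuadraticAlgebra.omega_mul_omega_eq_algebraMap]
  simp

theorem mul_map_eq_map_star_mul
    (hj : j * φ QuadraticAlgebra.omega = -(φ QuadraticAlgebra.omega * j))
    (m : QuadraticAlgebra F a 0) : j * φ m = φ (star m) * j := by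
  rw [map_quadraticAlgebra φ m, map_quadraticAlgebra φ (star m), mul_add, add_mul, mul_smul_comm,
    hj, ← Algebra.commutes m.re j]
  simp

section

variable [Fact (∀ r : F, r ^ 2 ≠ a + 0 * r)]

theorem notMem_range_of_anticommute (h2 : (2 : F) ≠ 0) (hj0 : j ≠ 0)
    (hj : j * φ QuadraticAlgebra.omega = -(φ QuadraticAlgebra.omega * j)) : j ∉ φ.range := by
  rintro ⟨m, hm⟩
  obtain rfl : φ m = j := hm
  have hm : m ≠ 0 := fun h => hj0 (h ▸ map_zero φ)
  have hφ : φ (QuadraticAlgebra.omega * m) = φ (star QuadraticAlgebra.omega * m) := by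
    rw [map_mul φ (star _), ← mul_map_eq_map_star_mul hj, ← map_mul, mul_comm]
  have hstar : (1 : F) = -1 :=
    congrArg QuadraticAlgebra.im (mul_right_cancel₀ hm (φ.toRingHom.injective hφ))
  exact h2 (by linear_combination hstar)

theorem sq_ne_mul_sq_add_of_anticommute (h2 : (2 : F) ≠ 0) (hj0 : j ≠ 0)
    (hj : j * φ QuadraticAlgebra.omega = -(φ QuadraticAlgebra.omega * j)) {b : F}
    (hb : j ^ 2 = algebraMap F D b) (x y : F) : x ^ 2 ≠ a * y ^ 2 + b := by
  intro hxy
  set α := φ QuadraticAlgebra.omega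
  have hα : α ^ 2 = algebraMap F D a := map_omega_sq φ
  have hsq : (y • α + j) * (y • α + j) = algebraMap F D x * algebraMap F D x := by
    rw [add_mul, mul_add, mul_add, mul_smul_comm y j, hj, smul_mul_assoc _ α j, smul_neg,
      ← add_assoc, add_neg_cancel_right, ← pow_two, ← pow_two, ← pow_two, smul_pow, hα, hb,
      Algebra.smul_def, ← map_mul, ← map_add, mul_comm, ← hxy, map_pow]
  have hmem : y • α + j ∈ φ.range := by
    rcases (Algebra.commute_algebraMap_right _ _).mul_self_eq_mul_self_iff.1 hsq with h | h <;>
      rw [h]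
    · exact algebraMap_mem _ _
    · exact neg_mem (algebraMap_mem _ _)
  have hyα : y • α ∈ φ.range := Subalgebra.smul_mem _ (φ.mem_range_self _) _
  exact notMem_range_of_anticommute h2 hj0 hj ((add_mem_cancel_left hyα).1 hmem)

theorem exists_sq_eq_algebraMap_of_anticommute [Algebra.IsCentral F D]
    (hD : Module.finrank F D = 4) (h2 : (2 : F) ≠ 0) (hj0 : j ≠ 0)
    (hj : j * φ QuadraticAlgebra.omega = -(φ QuadraticAlgebra.omega * j)) :
    ∃ d : F, j ^ 2 = algebraMap F D d := by
  have : FiniteDimensional F D := .of_finrank_pos (by omega)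
  suffices hcenter : j ^ 2 ∈ Subalgebra.center F D by
    obtain ⟨d, hd⟩ := Algebra.mem_bot.1 (Algebra.IsCentral.out hcenter)
    exact ⟨d, hd.symm⟩
  have hcomm (m) : Commute (φ m) (j ^ 2) := by
    change φ m * j ^ 2 = j ^ 2 * φ m
    rw [pow_two, mul_assoc j j (φ m), mul_map_eq_map_star_mul hj, ← mul_assoc j (φ _) j,
      mul_map_eq_map_star_mul hj, star_star, mul_assoc]
  refine Subalgebra.mem_center_iff.2 fun x => ?_
  obtain ⟨m, n, rfl⟩ := exists_add_mul_eq φ (by rw [hD, QuadraticAlgebra.finrank_eq_two])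
    (notMem_range_of_anticommute h2 hj0 hj) x
  exact (hcomm m).add_left ((hcomm n).mul_left (Commute.pow_right rfl 2))

theorem exists_algEquiv_quaternionAlgebra (hD : Module.finrank F D = 4) (hj_range : j ∉ φ.range)
    {b : F} (hj : j * φ QuadraticAlgebra.omega = -(φ QuadraticAlgebra.omega * j))
    (hb : j ^ 2 = algebraMap F D b) :
    ∃ e : QuaternionAlgebra F a 0 b ≃ₐ[F] D, ∀ m : QuadraticAlgebra F a 0,
      e ⟨m.re, m.im, 0, 0⟩ = φ m := by
  have : FiniteDimensional F D := .of_finrank_pos (by omega)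
  let α := φ QuadraticAlgebra.omega
  let q : QuaternionAlgebra.Basis D a 0 b :=
    { i := α
      j := j
      k := α * j
      i_mul_i := by
        rw [← map_mul, QuadraticAlgebra.omega_mul_omega_eq_algebraMap]
        simp [Algebra.algebraMap_eq_smul_one]
      j_mul_j := by rw [← pow_two, hb, Algebra.algebraMap_eq_smul_one]
      i_mul_j := rfl
      j_mul_i := by rw [hj, zero_smul, zero_sub] }
  have hq (x) : q.liftHom x = φ ⟨x.re, x.imI⟩ + φ ⟨x.imJ, x.imK⟩ * j := by
    change algebraMap F D x.re + x.imI • α + x.imJ • j + x.imK • (α * j) = _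
    rw [map_quadraticAlgebra φ ⟨x.re, x.imI⟩, map_quadraticAlgebra φ ⟨x.imJ, x.imK⟩, add_mul,
      Algebra.smul_def x.imJ, smul_mul_assoc, add_assoc _ (_ * j)]
  have hinj : Function.Injective q.liftHom := (injective_iff_map_eq_zero _).2 fun x hx => by
    rw [hq] at hx
    obtain ⟨hm, hn⟩ := eq_zero_of_add_mul_eq_zero φ hj_range hx
    rw [QuadraticAlgebra.ext_iff] at hm hn
    exact QuaternionAlgebra.ext hm.1 hm.2 hn.1 hn.2
  have hsurj : Function.Surjective q.liftHom :=
    (LinearMap.injective_iff_surjective_of_finrank_eq_finrank (f := q.liftHom.toLinearMap)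
      (by rw [QuaternionAlgebra.finrank_eq_four, hD])).1 hinj
  refine ⟨AlgEquiv.ofBijective q.liftHom ⟨hinj, hsurj⟩, fun m => (hq _).trans ?_⟩
  rw [show (⟨0, 0⟩ : QuadraticAlgebra F a 0) = 0 from rfl, map_zero, zero_mul, add_zero]

end

end

section

variable {F : Type*} [Field F]

theorem sq_ne_add_zero_mul_of_not_isSquare {a : F} (ha : ¬ IsSquare a) (r : F) :
    r ^ 2 ≠ a + 0 * r :=
  fun h => ha ⟨r, by linear_combination -h⟩

open ValuativeRel IsLocalRing

theorem not_isSquare_coe_of_not_isSquare_residue [ValuativeRel F] {ε : 𝒪[F]}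
    (hε : ¬ IsSquare (residue 𝒪[F] ε)) : ¬ IsSquare (ε : F) := by
  rintro ⟨r, hr⟩
  have hr_int : valuation F r ≤ 1 := by
    rw [← pow_le_one_iff two_ne_zero, ← map_pow, pow_two, ← hr]
    exact ε.2
  have hr' : ε = ⟨r, hr_int⟩ * ⟨r, hr_int⟩ := Subtype.ext hr
  exact hε ⟨_, (congrArg _ hr').trans (map_mul _ _ _)⟩

variable [ValuativeRel F] [TopologicalSpace F] [IsNonarchimedeanLocalField F]
  {D : Type*} [DivisionRing D] [Algebra F D] [Algebra.IsCentral F D]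

theorem exists_irreducible_sq_eq_of_anticommute (hF : ringChar 𝓀[F] ≠ 2)
    (hD : Module.finrank F D = 4) {ε : 𝒪[F]} (hε : ¬ IsSquare (residue 𝒪[F] ε))
    (φ : QuadraticAlgebra F (ε : F) 0 →ₐ[F] D) :
    ∃ (j : D) (π : 𝒪[F]), j ≠ 0 ∧ j * φ QuadraticAlgebra.omega = -(φ QuadraticAlgebra.omega * j) ∧
      Irreducible π ∧ j ^ 2 = algebraMap F D π := by
  have h2 := two_ne_zero_of_ringChar_residueField_ne_two hF
  have hεF := not_isSquare_coe_of_not_isSquare_residue hε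
  have : Fact (∀ r : F, r ^ 2 ≠ ε + 0 * r) := ⟨sq_ne_add_zero_mul_of_not_isSquare hεF⟩
  set α := φ QuadraticAlgebra.omega
  have hα : α ^ 2 = algebraMap F D ε := map_omega_sq φ
  have hα_center : α ∉ Subalgebra.center F D := fun h => by
    obtain ⟨a, ha⟩ := Algebra.mem_bot.1 (Algebra.IsCentral.out h)
    rw [← ha, ← map_pow] at hα
    exact hεF ⟨a, by rw [← pow_two, (algebraMap F D).injective hα]⟩
  obtain ⟨j, hj0, hj⟩ := exists_anticommute_of_notMem_center hα hα_center
  obtain ⟨d, hd⟩ := exists_sq_eq_algebraMap_of_anticommute hD h2 hj0 hj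
  have hd0 : d ≠ 0 := fun h => pow_ne_zero 2 hj0 (by rw [hd, h, map_zero])
  obtain ⟨t, ht, π, hπ, hdt⟩ := exists_isUnit_or_irreducible_mul_sq_eq 𝒪[F] hd0
  have hjt0 : t • j ≠ 0 := smul_ne_zero ht hj0
  have hjt : t • j * α = -(α * t • j) := by rw [smul_mul_assoc, hj, mul_smul_comm, smul_neg]
  have hjt_sq : (t • j) ^ 2 = algebraMap F D π := by
    rw [smul_pow, hd, Algebra.smul_def, ← map_mul, mul_comm, hdt]
    rfl
  refine ⟨t • j, π, hjt0, hjt, hπ.resolve_left fun hπ_unit => ?_, hjt_sq⟩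
  have hε_unit : IsUnit ε := (residue_ne_zero_iff_isUnit ε).1 fun h => hε (h ▸ IsSquare.zero)
  have := henselianLocalRing_integer F
  obtain ⟨a, b, hab⟩ := exists_sq_eq_mul_sq_add (isUnit_two_integer hF) hε_unit hπ_unit
  exact sq_ne_mul_sq_add_of_anticommute h2 hjt0 hjt hjt_sq a b (congrArg Subtype.val hab)

theorem exists_algEquiv_quaternionAlgebra_irreducible (hF : ringChar 𝓀[F] ≠ 2)
    (hD : Module.finrank F D = 4) {ε : 𝒪[F]} (hε : ¬ IsSquare (residue 𝒪[F] ε))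
    (φ : QuadraticAlgebra F (ε : F) 0 →ₐ[F] D) :
    ∃ π : 𝒪[F], Irreducible π ∧ ∃ e : QuaternionAlgebra F (ε : F) 0 (π : F) ≃ₐ[F] D,
      ∀ m : QuadraticAlgebra F (ε : F) 0, e ⟨m.re, m.im, 0, 0⟩ = φ m := by
  have : Fact (∀ r : F, r ^ 2 ≠ ε + 0 * r) :=
    ⟨sq_ne_add_zero_mul_of_not_isSquare (not_isSquare_coe_of_not_isSquare_residue hε)⟩
  obtain ⟨j, π, hj0, hj, hπ, hsq⟩ := exists_irreducible_sq_eq_of_anticommute hF hD hε φ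
  exact ⟨π, hπ, exists_algEquiv_quaternionAlgebra hD (notMem_range_of_anticommute
    (two_ne_zero_of_ringChar_residueField_ne_two hF) hj0 hj) hj hsq⟩

end

end Quaternion

section QuaternionValuation

open ValuativeRel IsLocalRing Quaternion

variable {F : Type*} [Field F] [ValuativeRel F]

theorem valuation_norm_quadraticAlgebra {ε : 𝒪[F]} (hε : ¬ IsSquare (residue 𝒪[F] ε))
    (m : QuadraticAlgebra F (ε : F) 0) :
    valuation F m.norm = max (valuation F m.re) (valuation F m.im) ^ 2 := by
  have hnorm : m.norm = m.re ^ 2 + -(ε * m.im ^ 2) := by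
    rw [QuadraticAlgebra.norm_def]
    ring
  rw [hnorm]
  rcases lt_or_ge (valuation F m.im) (valuation F m.re) with h | h
  · have hlt : valuation F (-(ε * m.im ^ 2)) < valuation F (m.re ^ 2) := by
      rw [Valuation.map_neg, map_mul, map_pow, map_pow]
      exact (mul_le_of_le_one_left zero_le ε.2).trans_lt (pow_lt_pow_left₀ h zero_le two_ne_zero)
    rw [Valuation.map_add_eq_of_lt_left _ hlt, max_eq_left h.le, map_pow]
  · rw [max_eq_right h]
    rcases eq_or_ne m.im 0 with him | him
    · have hre : m.re = 0 := by
        simpa only [him, map_zero, le_zero_iff, map_eq_zero] using h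
      simp [hre, him]
    · have hr : valuation F (m.re / m.im) ≤ 1 := by
        rw [map_div₀]
        exact div_le_one_of_le₀ h zero_le
      let r : 𝒪[F] := ⟨m.re / m.im, hr⟩
      have hunit : IsUnit (r ^ 2 - ε) := (residue_ne_zero_iff_isUnit _).1 fun h0 =>
        hε ⟨residue 𝒪[F] r, by rw [← pow_two, ← map_pow, eq_comm, ← sub_eq_zero, ← map_sub, h0]⟩
      have hval : valuation F ((r ^ 2 - ε : 𝒪[F]) : F) = 1 :=
        (Valuation.integer.integers (valuation F)).one_of_isUnit hunit
      have hfactor : m.re ^ 2 + -(ε * m.im ^ 2) = m.im ^ 2 * ((r ^ 2 - ε : 𝒪[F]) : F) := by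
        change _ = m.im ^ 2 * ((m.re / m.im) ^ 2 - ε)
        field_simp
        ring
      rw [hfactor, map_mul, hval, mul_one, map_pow]

/-- The valuation of `F(√ε)` given by the valuation of the norm. For `a : F` it takes the value
`valuation F a ^ 2`. -/
noncomputable def unramifiedValuation {ε : 𝒪[F]} (hε : ¬ IsSquare (residue 𝒪[F] ε)) :
    Valuation (QuadraticAlgebra F (ε : F) 0) (ValueGroupWithZero F) where
  toFun m := valuation F m.norm
  map_zero' := by simp
  map_one' := by simp
  map_mul' m n := by rw [map_mul, map_mul]
  map_add_le_max' m n := by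
    have hmax (a b : ValueGroupWithZero F) : max a b ^ 2 = max (a ^ 2) (b ^ 2) :=
      (pow_left_mono 2).map_max
    simp only [valuation_norm_quadraticAlgebra hε, ← hmax, QuadraticAlgebra.re_add,
      QuadraticAlgebra.im_add]
    rw [max_max_max_comm]
    gcongr <;> exact Valuation.map_add _ _ _

section

variable {ε : 𝒪[F]} (hε : ¬ IsSquare (residue 𝒪[F] ε))

theorem unramifiedValuation_apply (m : QuadraticAlgebra F (ε : F) 0) :
    unramifiedValuation hε m = max (valuation F m.re) (valuation F m.im) ^ 2 :=
  valuation_norm_quadraticAlgebra hε m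

theorem exists_unramifiedValuation_eq_sq (m : QuadraticAlgebra F (ε : F) 0) :
    ∃ a : F, unramifiedValuation hε m = valuation F a ^ 2 := by
  rw [unramifiedValuation_apply]
  rcases max_choice (valuation F m.re) (valuation F m.im) with h | h <;> exact ⟨_, by rw [h]⟩

theorem unramifiedValuation_le_one_iff {m : QuadraticAlgebra F (ε : F) 0} :
    unramifiedValuation hε m ≤ 1 ↔ valuation F m.re ≤ 1 ∧ valuation F m.im ≤ 1 := by
  rw [unramifiedValuation_apply, pow_le_one_iff two_ne_zero, max_le_iff]

theorem unramifiedValuation_lt_one_iff {m : QuadraticAlgebra F (ε : F) 0} :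
    unramifiedValuation hε m < 1 ↔ valuation F m.re < 1 ∧ valuation F m.im < 1 := by
  rw [unramifiedValuation_apply, pow_lt_one_iff two_ne_zero, max_lt_iff]

end

/-- The reduced norm of the quaternion algebra generated by anticommuting square roots of `a`
and `b`. -/
def quaternionNorm (a b : F) : ℍ[F,a,0,b] →*₀ F where
  toFun x := (⟨x.re, x.imI⟩ : QuadraticAlgebra F a 0).norm -
    b * (⟨x.imJ, x.imK⟩ : QuadraticAlgebra F a 0).norm
  map_zero' := by simp [QuadraticAlgebra.norm_def]
  map_one' := by simp [QuadraticAlgebra.norm_def]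
  map_mul' x y := by
    simp only [QuadraticAlgebra.norm_def, QuaternionAlgebra.re_mul, QuaternionAlgebra.imI_mul,
      QuaternionAlgebra.imJ_mul, QuaternionAlgebra.imK_mul]
    ring

section

variable [TopologicalSpace F] [IsNonarchimedeanLocalField F] {ε π : 𝒪[F]}
  (hε : ¬ IsSquare (residue 𝒪[F] ε)) (hπ : Irreducible π)

include hπ in
theorem valuation_quaternionNorm (x : ℍ[F,(ε : F),0,(π : F)]) :
    valuation F (quaternionNorm (ε : F) π x) = max (unramifiedValuation hε ⟨x.re, x.imI⟩)
      (valuation F π * unramifiedValuation hε ⟨x.imJ, x.imK⟩) := by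
  let m : QuadraticAlgebra F (ε : F) 0 := ⟨x.re, x.imI⟩
  let n : QuadraticAlgebra F (ε : F) 0 := ⟨x.imJ, x.imK⟩
  have hmap : valuation F (-(π * n.norm)) = valuation F π * unramifiedValuation hε n := by
    rw [Valuation.map_neg, map_mul]
    rfl
  change valuation F (m.norm - π * n.norm) =
    max (valuation F m.norm) (valuation F π * unramifiedValuation hε n)
  rw [← hmap, sub_eq_add_neg]
  by_cases h : valuation F m.norm = valuation F (-(π * n.norm))
  · -- The valuations of the two summands have different parities, so both vanish.
    obtain ⟨a, ha⟩ := exists_unramifiedValuation_eq_sq hε m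
    obtain ⟨b, hb⟩ := exists_unramifiedValuation_eq_sq hε n
    have hm : valuation F m.norm = valuation F a ^ 2 := ha
    have hb0 : b = 0 := by
      by_contra hb0
      refine valuation_ne_valuation_sq_of_irreducible hπ (a / b) ?_
      rw [map_div₀, div_pow, ← hm, h, hmap, hb, mul_div_cancel_right₀ _ (by simpa using hb0)]
    have h0 : valuation F (-(π * n.norm)) = 0 := by
      rw [hmap, hb, hb0, map_zero, zero_pow two_ne_zero, mul_zero]
    rw [h0] at h
    rw [(map_eq_zero _).1 h0, (map_eq_zero _).1 h, add_zero, max_self]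
  · exact Valuation.map_add_of_distinct_val _ h

/-- The valuation of a quaternion division algebra given by the valuation of the reduced norm. -/
noncomputable def quaternionValuation {ε π : 𝒪[F]} (hε : ¬ IsSquare (residue 𝒪[F] ε))
    (hπ : Irreducible π) :
    Valuation ℍ[F,(ε : F),0,(π : F)] (ValueGroupWithZero F) where
  toMonoidWithZeroHom := (valuation F).toMonoidWithZeroHom.comp (quaternionNorm (ε : F) π)
  map_add_le_max' x y := by
    change valuation F (quaternionNorm _ _ _) ≤
      max (valuation F (quaternionNorm _ _ _)) (valuation F (quaternionNorm _ _ _))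
    simp only [valuation_quaternionNorm hε hπ]
    rw [max_max_max_comm, ← mul_max]
    gcongr
    · exact (unramifiedValuation hε).map_add ⟨x.re, x.imI⟩ ⟨y.re, y.imI⟩
    · exact (unramifiedValuation hε).map_add ⟨x.imJ, x.imK⟩ ⟨y.imJ, y.imK⟩

theorem quaternionValuation_apply (x : ℍ[F,(ε : F),0,(π : F)]) :
    quaternionValuation hε hπ x = max (unramifiedValuation hε ⟨x.re, x.imI⟩)
      (valuation F π * unramifiedValuation hε ⟨x.imJ, x.imK⟩) :=
  valuation_quaternionNorm hε hπ x

theorem quaternionValuation_le_one_iff {x : ℍ[F,(ε : F),0,(π : F)]} :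
    quaternionValuation hε hπ x ≤ 1 ↔ unramifiedValuation hε ⟨x.re, x.imI⟩ ≤ 1 ∧
      unramifiedValuation hε ⟨x.imJ, x.imK⟩ ≤ 1 := by
  rw [quaternionValuation_apply, max_le_iff]
  refine and_congr_right fun _ => ⟨fun h => ?_, fun h =>
    mul_le_one' (valuation_lt_one_of_irreducible hπ).le h⟩
  obtain ⟨b, hb⟩ := exists_unramifiedValuation_eq_sq hε ⟨x.imJ, x.imK⟩
  rw [hb] at h ⊢
  refine pow_le_one' (not_lt.1 fun hb1 => h.not_gt ?_) 2
  have hinv : (valuation F b)⁻¹ ≤ valuation F π := by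
    rw [← map_inv₀]
    exact valuation_le_of_irreducible hπ (by rw [map_inv₀]; exact inv_lt_one_of_one_lt₀ hb1)
  calc 1 < valuation F b := hb1
    _ = (valuation F b)⁻¹ * valuation F b ^ 2 := by
      rw [pow_two, inv_mul_cancel_left₀ (zero_lt_one.trans hb1).ne']
    _ ≤ valuation F π * valuation F b ^ 2 := mul_le_mul_left hinv _

theorem exists_quaternionValuation_eq_zpow {x : ℍ[F,(ε : F),0,(π : F)]}
    (hx : quaternionValuation hε hπ x ≠ 0) :
    ∃ n : ℤ, quaternionValuation hε hπ x = valuation F π ^ n :=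
  exists_valuation_eq_zpow hπ ((Valuation.ne_zero_iff (valuation F)).1 hx)

theorem quaternionValuation_smul (a : F) (x : ℍ[F,(ε : F),0,(π : F)]) :
    quaternionValuation hε hπ (a • x) = valuation F a ^ 2 * quaternionValuation hε hπ x := by
  have h : quaternionNorm (ε : F) π (algebraMap F _ a) = a ^ 2 := by
    simp [quaternionNorm, QuadraticAlgebra.norm_def, pow_two]
  rw [Algebra.smul_def, map_mul, ← map_pow, ← h]
  rfl

theorem quaternionValuation_mk_re_imI (m : QuadraticAlgebra F (ε : F) 0) :
    quaternionValuation hε hπ ⟨m.re, m.im, 0, 0⟩ = unramifiedValuation hε m := by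
  simp [quaternionValuation_apply, unramifiedValuation_apply]

theorem quaternionValuation_j : quaternionValuation hε hπ ⟨0, 0, 1, 0⟩ = valuation F π := by
  simp [quaternionValuation_apply, unramifiedValuation_apply]

theorem exists_unramifiedValuation_eq_one_of_quaternionValuation_eq_one
    {x : ℍ[F,(ε : F),0,(π : F)]} (hx : quaternionValuation hε hπ x = 1) :
    ∃ m : QuadraticAlgebra F (ε : F) 0, unramifiedValuation hε m = 1 ∧
      quaternionValuation hε hπ (x - ⟨m.re, m.im, 0, 0⟩) < 1 := by
  have hint := ((quaternionValuation_le_one_iff hε hπ).1 hx.le).2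
  have hlt : quaternionValuation hε hπ (x - ⟨x.re, x.imI, 0, 0⟩) < 1 := by
    have hcoord : x - ⟨x.re, x.imI, 0, 0⟩ = ⟨0, 0, x.imJ, x.imK⟩ := by ext <;> simp
    have h0 : unramifiedValuation hε ⟨0, 0⟩ = 0 := map_zero _
    rw [hcoord, quaternionValuation_apply, h0, max_eq_right zero_le]
    exact mul_lt_one_of_lt_of_le (valuation_lt_one_of_irreducible hπ) hint
  refine ⟨⟨x.re, x.imI⟩, ?_, hlt⟩
  rw [← quaternionValuation_mk_re_imI hε hπ, ← hx]
  exact Valuation.map_eq_of_sub_lt _ (by rwa [Valuation.map_sub_swap, hx])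

end

end QuaternionValuation

section ValuationTopology

open ValuativeRel

variable {F : Type*} [Field F] [ValuativeRel F] [TopologicalSpace F] [IsNonarchimedeanLocalField F]
  {D : Type*} [Ring D] [Module F D] [TopologicalSpace D] [IsModuleTopology F D]
  {W : Valuation D (ValueGroupWithZero F)}

theorem setOf_valuation_lt_mem_nhds_zero [Module.Finite F D]
    (hW : ∀ (a : F) x, W (a • x) = valuation F a ^ 2 * W x) {γ : ValueGroupWithZero F}
    (hγ : γ ≠ 0) : {x | W x < γ} ∈ 𝓝 0 := by
  let b := Module.finBasis F D
  have hcoord (i) : ∀ᶠ x in 𝓝 (0 : D), W (b.coord i x • b i) < γ := by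
    have hc : max 1 (W (b i)) ≠ 0 := (zero_lt_one.trans_le (le_max_left _ _)).ne'
    have hδ : min 1 (γ / max 1 (W (b i))) ≠ 0 :=
      (lt_min zero_lt_one (zero_lt_iff.2 (div_ne_zero hγ hc))).ne'
    have hcont : Filter.Tendsto (b.coord i) (𝓝 0) (𝓝 0) := by
      simpa only [map_zero] using
        (IsModuleTopology.continuous_of_linearMap (b.coord i)).tendsto 0
    filter_upwards [hcont ((IsValuativeTopology.hasBasis_nhds_zero' F).mem_of_mem hδ)] with x hx
    obtain ⟨hx1, hxγ⟩ : valuation F (b.coord i x) < 1 ∧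
        valuation F (b.coord i x) < γ / max 1 (W (b i)) := lt_min_iff.1 hx
    calc W (b.coord i x • b i) = valuation F (b.coord i x) ^ 2 * W (b i) := hW _ _
      _ ≤ valuation F (b.coord i x) * max 1 (W (b i)) :=
        mul_le_mul' (pow_le_of_le_one zero_le hx1.le two_ne_zero) (le_max_right _ _)
      _ < γ := (lt_div_iff₀ (zero_lt_iff.2 hc)).1 hxγ
  filter_upwards [Filter.eventually_all.2 hcoord] with x hx
  calc W x = W (∑ i, b.coord i x • b i) := by simp only [Module.Basis.coord_apply, b.sum_repr]
    _ < γ := W.map_sum_lt hγ fun i _ => hx i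

theorem hasBasis_nhds_zero_of_isCompact [Module.Finite F D]
    (hW : ∀ (a : F) x, W (a • x) = valuation F a ^ 2 * W x) {C : Set D} (hC : IsCompact C)
    (hWC : {x | W x ≤ 1} ⊆ C) :
    (𝓝 (0 : D)).HasBasis (fun γ : ValueGroupWithZero F => γ ≠ 0) fun γ => {x | W x < γ} := by
  have := IsModuleTopology.toContinuousSMul F D
  refine ⟨fun N => ⟨fun hN => ?_, fun ⟨γ, hγ, hγN⟩ =>
    Filter.mem_of_superset (setOf_valuation_lt_mem_nhds_zero hW hγ) hγN⟩⟩
  -- By compactness, scaling by small `a` shrinks all of `C` into `N`.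
  have hscale : ∀ᶠ a in 𝓝 (0 : F), ∀ x ∈ C, a • x ∈ N :=
    hC.eventually_forall_of_forall_eventually fun x _ =>
      (continuous_smul.tendsto' ((0 : F), x) 0 (zero_smul F x)) hN
  obtain ⟨δ, hδ, hδN⟩ := (IsValuativeTopology.hasBasis_nhds_zero' F).mem_iff.1 hscale
  obtain ⟨a, ha0, haδ⟩ : ∃ a : F, a ≠ 0 ∧ valuation F a < δ := by
    obtain ⟨π, hπ⟩ := IsDiscreteValuationRing.exists_irreducible 𝒪[F]
    obtain ⟨d, rfl⟩ := valuation_surjective δ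
    refine ⟨d * π, mul_ne_zero ((Valuation.ne_zero_iff _).1 hδ) (by simpa using hπ.ne_zero), ?_⟩
    rw [map_mul]
    exact mul_lt_of_lt_one_right (zero_lt_iff.2 hδ) (valuation_lt_one_of_irreducible hπ)
  refine ⟨valuation F a ^ 2, pow_ne_zero 2 ((Valuation.ne_zero_iff _).2 ha0), fun x hx => ?_⟩
  have hx1 : W (a⁻¹ • x) ≤ 1 := by
    have hva : 0 < valuation F a ^ 2 := pow_pos (zero_lt_iff.2 ((Valuation.ne_zero_iff _).2 ha0)) 2
    rw [hW, map_inv₀, inv_pow, inv_mul_le_one₀ hva]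
    exact le_of_lt hx
  simpa only [smul_inv_smul₀ ha0] using hδN haδ _ (hWC hx1)

end ValuationTopology

section PrincipalUnits

variable {D Γ₀ : Type*} [DivisionRing D] [LinearOrderedCommGroupWithZero Γ₀] {W : Valuation D Γ₀}

theorem valuation_eq_one_of_valuation_sub_one_lt_one {x : D} (hx : W (x - 1) < 1) : W x = 1 := by
  rw [← sub_add_cancel x 1, Valuation.map_add_eq_of_lt_right _ (by rwa [map_one]), map_one]

/-- The principal units of level `γ` of a valued division ring. Levels above `1` are cut off at
`1`, so that these always form a group. -/
def principalUnits (W : Valuation D Γ₀) (γ : Γ₀ˣ) : Subgroup Dˣ where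
  carrier := {x | W ((x : D) - 1) < min (γ : Γ₀) 1}
  one_mem' := by simp [zero_lt_iff]
  mul_mem' {x y} hx hy := by
    have hy1 : W (y : D) = 1 := valuation_eq_one_of_valuation_sub_one_lt_one
      (lt_of_lt_of_le hy (min_le_right _ _))
    have h : ((x * y : Dˣ) : D) - 1 = (x - 1) * y + (y - 1) := by
      rw [Units.val_mul, sub_mul, one_mul, sub_add_sub_cancel]
    rw [Set.mem_ofPred_eq, h]
    refine W.map_add_lt ?_ hy
    rw [map_mul, hy1, mul_one]
    exact hx
  inv_mem' {x} hx := by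
    have hx1 : W (x : D) = 1 := valuation_eq_one_of_valuation_sub_one_lt_one
      (lt_of_lt_of_le hx (min_le_right _ _))
    have h : ((x⁻¹ : Dˣ) : D) - 1 = ((x⁻¹ : Dˣ) : D) * (1 - x) := by
      rw [mul_sub, Units.inv_mul, mul_one]
    rw [Set.mem_ofPred_eq, h, map_mul, Units.val_inv_eq_inv_val, map_inv₀, hx1, inv_one, one_mul,
      Valuation.map_sub_swap]
    exact hx

theorem mem_principalUnits_iff {γ : Γ₀ˣ} {x : Dˣ} :
    x ∈ principalUnits W γ ↔ W ((x : D) - 1) < min (γ : Γ₀) 1 :=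
  Iff.rfl

theorem principalUnits_mono : Monotone (principalUnits W) := fun _ _ hγ _ hx =>
  mem_principalUnits_iff.2 (lt_of_lt_of_le hx (min_le_min_right 1 (Units.val_le_val.2 hγ)))

theorem mem_principalUnits_one_iff {x : Dˣ} : x ∈ principalUnits W 1 ↔ W ((x : D) - 1) < 1 := by
  rw [mem_principalUnits_iff, Units.val_one, min_self]

theorem principalUnits_le_one (γ : Γ₀ˣ) : principalUnits W γ ≤ principalUnits W 1 := fun _ hx =>
  mem_principalUnits_one_iff.2 (lt_of_lt_of_le hx (min_le_right _ _))

theorem valuation_eq_one_of_mem_principalUnits_one {x : Dˣ} (hx : x ∈ principalUnits W 1) :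
    W (x : D) = 1 :=
  valuation_eq_one_of_valuation_sub_one_lt_one (mem_principalUnits_one_iff.1 hx)

instance principalUnits_normal (γ : Γ₀ˣ) : (principalUnits W γ).Normal where
  conj_mem x hx g := by
    have h : ((g * x * g⁻¹ : Dˣ) : D) - 1 = g * (x - 1) * ((g⁻¹ : Dˣ) : D) := by
      simp [mul_sub, sub_mul]
    rw [mem_principalUnits_iff, h, map_mul, map_mul, mul_right_comm, ← map_mul, Units.mul_inv,
      map_one, one_mul]
    exact hx

theorem inv_mul_mem_principalUnits_iff {γ : Γ₀ˣ} {x y : Dˣ} (hx : W (x : D) = 1) :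
    x⁻¹ * y ∈ principalUnits W γ ↔ W ((x : D) - y) < min (γ : Γ₀) 1 := by
  have h : ((x⁻¹ * y : Dˣ) : D) - 1 = ((x⁻¹ : Dˣ) : D) * (y - x) := by simp [mul_sub]
  rw [mem_principalUnits_iff, h, map_mul, Units.val_inv_eq_inv_val, map_inv₀, hx, inv_one, one_mul,
    Valuation.map_sub_swap]

theorem mk_eq_mk_principalUnits_one_iff {x y : Dˣ} (hx : W (x : D) = 1) :
    (x : Dˣ ⧸ principalUnits W 1) = y ↔ W ((x : D) - y) < 1 := by
  rw [QuotientGroup.eq, inv_mul_mem_principalUnits_iff hx, Units.val_one, min_self]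

section

variable [TopologicalSpace D] [IsTopologicalRing D]
  (hW : (𝓝 (0 : D)).HasBasis (fun γ : Γ₀ => γ ≠ 0) fun γ => {x | W x < γ})

include hW

theorem principalUnits_mem_nhds_one (γ : Γ₀ˣ) : (principalUnits W γ : Set Dˣ) ∈ 𝓝 1 := by
  have hsub : Filter.Tendsto (fun x : Dˣ => (x : D) - 1) (𝓝 1) (𝓝 0) :=
    (Units.continuous_val.sub continuous_const).tendsto' _ _ (by simp)
  exact hsub (hW.mem_of_mem (lt_min (zero_lt_iff.2 γ.ne_zero) zero_lt_one).ne')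

theorem exists_principalUnits_subset {N : Set Dˣ} (hN : N ∈ 𝓝 1) :
    ∃ γ : Γ₀ˣ, (principalUnits W γ : Set Dˣ) ⊆ N := by
  have hbasis {C : Set D} (hC : C ∈ 𝓝 (1 : D)) :
      ∃ γ : Γ₀ˣ, ∀ x ∈ principalUnits W γ, (x : D) ∈ C := by
    have hadd : Filter.Tendsto (fun x : D => x + 1) (𝓝 0) (𝓝 1) :=
      (continuous_add_const (1 : D)).tendsto' _ _ (zero_add 1)
    obtain ⟨γ, hγ, h⟩ := hW.mem_iff.1 (hadd hC)
    refine ⟨Units.mk0 γ hγ, fun x hx => ?_⟩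
    simpa only [Set.mem_preimage, sub_add_cancel] using
      h (lt_of_lt_of_le hx (min_le_left _ _))
  -- Neighbourhoods in `Dˣ` also control the inverse.
  rw [Units.isInducing_embedProduct.nhds_eq_comap, map_one, Filter.mem_comap] at hN
  obtain ⟨t, ht, htN⟩ := hN
  obtain ⟨A, hA, B, hB, hAB⟩ := mem_nhds_prod_iff.1 ht
  obtain ⟨γ, hγ⟩ := hbasis hA
  obtain ⟨δ, hδ⟩ := hbasis (MulOpposite.continuous_op.continuousAt.preimage_mem_nhds hB)
  exact ⟨min γ δ, fun x hx => htN (hAB ⟨hγ x (principalUnits_mono (min_le_left _ _) hx),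
    hδ x⁻¹ (principalUnits_mono (min_le_right _ _) (inv_mem hx))⟩)⟩

theorem finite_principalUnits_quotient {C : Set D} (hC : IsCompact C) (hWC : {x | W x ≤ 1} ⊆ C)
    (γ : Γ₀ˣ) :
    Finite (principalUnits W 1 ⧸ (principalUnits W γ).subgroupOf (principalUnits W 1)) := by
  let B : AddSubgroup D := W.ltAddSubgroup (min γ 1)
  have hB : IsOpen (B : Set D) := B.isOpen_of_mem_nhds (hW.mem_of_mem (min γ 1).ne_zero)
  have : DiscreteTopology (D ⧸ B) := QuotientAddGroup.discreteTopology hB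
  have hfin : ((QuotientAddGroup.mk : D → D ⧸ B) '' C).Finite :=
    (hC.image QuotientAddGroup.continuous_mk).finite_of_discrete
  have := hfin.to_subtype
  have hW1 (x : principalUnits W 1) : W ((x : Dˣ) : D) = 1 :=
    valuation_eq_one_of_mem_principalUnits_one x.2
  refine Finite.of_injective (β := (QuotientAddGroup.mk : D → D ⧸ B) '' C)
    (fun a => ⟨QuotientAddGroup.mk ((a.out : Dˣ) : D), _, hWC (hW1 a.out).le, rfl⟩)
    fun a b hab => ?_
  rw [← QuotientGroup.out_eq' a, ← QuotientGroup.out_eq' b, QuotientGroup.eq]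
  refine (inv_mul_mem_principalUnits_iff (hW1 a.out)).2 ?_
  have hlt : W (-((a.out : Dˣ) : D) + ((b.out : Dˣ) : D)) < (min γ 1 : Γ₀ˣ) :=
    QuotientAddGroup.eq.1 (congrArg Subtype.val hab)
  rwa [Units.min_val, Units.val_one, neg_add_eq_sub, Valuation.map_sub_swap] at hlt

end

theorem mem_principalUnits_of_sq_mem (h2 : W 2 = 1) {γ : Γ₀ˣ} {x : Dˣ}
    (hx : x ∈ principalUnits W 1) (hx2 : x ^ 2 ∈ principalUnits W γ) : x ∈ principalUnits W γ := by
  have hadd : W ((x : D) + 1) = 1 := by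
    rw [show (x : D) + 1 = (x - 1) + 2 by rw [← one_add_one_eq_two]; abel,
      Valuation.map_add_eq_of_lt_right _ (by rwa [h2, ← mem_principalUnits_one_iff]), h2]
  have hfactor : ((x ^ 2 : Dˣ) : D) - 1 = (x - 1) * (x + 1) := by
    rw [Units.val_pow_eq_pow_val]
    noncomm_ring
  rw [mem_principalUnits_iff, hfactor, map_mul, hadd, mul_one] at hx2
  exact hx2

theorem hasOddNormalBasis_principalUnits_one [TopologicalSpace D] [IsTopologicalRing D]
    (hW : (𝓝 (0 : D)).HasBasis (fun γ : Γ₀ => γ ≠ 0) fun γ => {x | W x < γ}) {C : Set D}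
    (hC : IsCompact C) (hWC : {x | W x ≤ 1} ⊆ C) (h2 : W 2 = 1) :
    HasOddNormalBasis (principalUnits W 1) := by
  intro N hN
  obtain ⟨γ, hγ⟩ := exists_principalUnits_subset hW hN
  refine ⟨principalUnits W γ, principalUnits_mem_nhds_one hW γ, hγ, inferInstance,
    principalUnits_le_one γ, Nat.not_even_iff_odd.1 fun heven => ?_⟩
  have := finite_principalUnits_quotient hW hC hWC γ
  obtain ⟨a, ha⟩ := exists_prime_orderOf_dvd_card' 2 (even_iff_two_dvd.1 heven)
  obtain ⟨x, rfl⟩ := QuotientGroup.mk_surjective a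
  have hx2 : x ^ 2 ∈ (principalUnits W γ).subgroupOf (principalUnits W 1) := by
    rw [← QuotientGroup.eq_one_iff, QuotientGroup.mk_pow, ← ha, pow_orderOf_eq_one]
  have hx : x ∈ (principalUnits W γ).subgroupOf (principalUnits W 1) :=
    mem_principalUnits_of_sq_mem h2 x.2 hx2
  rw [(QuotientGroup.eq_one_iff x).2 hx, orderOf_one] at ha
  exact absurd ha (by norm_num)

theorem zpowers_sup_zpowers_eq_top {z w : Dˣ} (hw : ∀ x : Dˣ, ∃ n : ℤ, W (x : D) = W (w : D) ^ n)
    (hz : ∀ x : Dˣ, W (x : D) = 1 → ∃ n : ℕ, W ((x : D) - (z : D) ^ n) < 1) :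
    Subgroup.zpowers (w : Dˣ ⧸ principalUnits W 1) ⊔
      Subgroup.zpowers (z : Dˣ ⧸ principalUnits W 1) = ⊤ := by
  refine eq_top_iff.2 fun a _ => ?_
  obtain ⟨x, rfl⟩ := QuotientGroup.mk_surjective a
  obtain ⟨n, hn⟩ := hw x
  have hunit : W ((w ^ (-n) * x : Dˣ) : D) = 1 := by
    have hwn : W (w : D) ^ n ≠ 0 := zpow_ne_zero n ((Valuation.ne_zero_iff _).2 w.ne_zero)
    rw [Units.val_mul, map_mul, hn, Units.val_zpow_eq_zpow_val, map_zpow₀, zpow_neg,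
      inv_mul_cancel₀ hwn]
  obtain ⟨m, hm⟩ := hz _ hunit
  have hx : (x : Dˣ ⧸ principalUnits W 1) = (w : Dˣ ⧸ principalUnits W 1) ^ n * z ^ m := by
    have hmk : ((w ^ (-n) * x : Dˣ) : Dˣ ⧸ principalUnits W 1) = (z ^ m : Dˣ) :=
      (mk_eq_mk_principalUnits_one_iff hunit).2 (by rwa [Units.val_pow_eq_pow_val])
    rw [← QuotientGroup.mk_pow, ← hmk, QuotientGroup.mk_mul, QuotientGroup.mk_zpow, zpow_neg,
      mul_inv_cancel_left]
  rw [hx]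
  exact Subgroup.mul_mem_sup (zpow_mem (Subgroup.mem_zpowers _) n)
    (pow_mem (Subgroup.mem_zpowers _) m)

theorem eq_zero_of_zpow_mem_zpowers {z w : Dˣ} (hz : W (z : D) = 1) (hw : W (w : D) < 1) {k : ℤ}
    (hk : ((w : Dˣ ⧸ principalUnits W 1) ^ k) ∈ Subgroup.zpowers (z : Dˣ ⧸ principalUnits W 1)) :
    k = 0 := by
  obtain ⟨j, hj⟩ := Subgroup.mem_zpowers_iff.1 hk
  have hmem : (z ^ j)⁻¹ * w ^ k ∈ principalUnits W 1 := QuotientGroup.eq.1 hj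
  have hone := valuation_eq_one_of_mem_principalUnits_one hmem
  rw [Units.val_mul, map_mul, Units.val_inv_eq_inv_val, Units.val_zpow_eq_zpow_val,
    Units.val_zpow_eq_zpow_val, map_inv₀, map_zpow₀, map_zpow₀, hz, one_zpow, inv_one,
    one_mul] at hone
  exact zpow_right_injective₀ (zero_lt_iff.2 ((Valuation.ne_zero_iff _).2 w.ne_zero)) hw.ne
    (hone.trans (zpow_zero _).symm)

/-- Here `z` generates the residue field and `w` the value group, and `w` acts on the residue field
as the `q`-th power map. -/
theorem TwoFoldCover.extensionSplits_of_hasOddNormalBasis_principalUnits [TopologicalSpace D]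
    [IsTopologicalRing D] {E : Type*} [Group E] [TopologicalSpace E] [IsTopologicalGroup E]
    (c : TwoFoldCover Dˣ E) (hodd : HasOddNormalBasis (principalUnits W 1)) {z w : Dˣ} {q : ℕ}
    (hq : 1 < q) (hz : W (z : D) = 1)
    (hzgen : ∀ x : Dˣ, W (x : D) = 1 → ∃ n : ℕ, W ((x : D) - (z : D) ^ n) < 1)
    (hzord : ∀ n : ℕ, W (1 - (z : D) ^ n) < 1 → q ^ 2 - 1 ∣ n) (hw : W (w : D) < 1)
    (hwgen : ∀ x : Dˣ, ∃ n : ℤ, W (x : D) = W (w : D) ^ n)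
    (hwz : W ((w * z * w⁻¹ : Dˣ) - (z : D) ^ q) < 1) {A : Subgroup Dˣ} (hzA : z ∈ A)
    (hwA : w ^ 2 ∈ A) (hcomm : Commute z (w ^ 2)) (hA : ExtensionSplitsOver c.complexProj A) :
    ExtensionSplits c.complexProj := by
  have hconj : W ((w * z * w⁻¹ : Dˣ) : D) = 1 := by
    rw [Units.val_mul, Units.val_mul, map_mul, map_mul, mul_right_comm, ← map_mul, Units.mul_inv,
      map_one, one_mul, hz]
  refine c.extensionSplits_complexProj hodd hq ?_ (hzord _ ?_)
    (fun k hk => eq_zero_of_zpow_mem_zpowers hz hw hk) (zpowers_sup_zpowers_eq_top hwgen hzgen) hA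
    hzA hwA hcomm
  · rw [← QuotientGroup.mk_pow]
    exact (mk_eq_mk_principalUnits_one_iff hconj).2 (by rwa [Units.val_pow_eq_pow_val])
  · rw [← Units.val_one, ← Units.val_pow_eq_pow_val,
      ← mk_eq_mk_principalUnits_one_iff (by rw [Units.val_one, map_one]), QuotientGroup.mk_pow,
      pow_orderOf_eq_one, QuotientGroup.mk_one]

end PrincipalUnits

section ResidueField

open ValuativeRel IsLocalRing

theorem quadraticAlgebra_pow_card_eq_star {k : Type*} [Field k] [Finite k] {e : k}
    (he : ¬ IsSquare e) (m : QuadraticAlgebra k e 0) : m ^ Nat.card k = star m := by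
  have : Fact (∀ r : k, r ^ 2 ≠ e + 0 * r) := ⟨sq_ne_add_zero_mul_of_not_isSquare he⟩
  have := Fintype.ofFinite k
  rw [Nat.card_eq_fintype_card]
  have hchar : ringChar k ≠ 2 := fun h => he (FiniteField.isSquare_of_char_two h e)
  have he0 : e ≠ 0 := fun h => he (h ▸ IsSquare.zero)
  have heuler : e ^ (Fintype.card k / 2) = -1 :=
    (FiniteField.pow_dichotomy hchar he0).resolve_left fun h =>
      he ((FiniteField.isSquare_iff hchar he0).2 h)
  have homega : (QuadraticAlgebra.omega : QuadraticAlgebra k e 0) ^ Fintype.card k =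
      -QuadraticAlgebra.omega := by
    have hsq : (QuadraticAlgebra.omega : QuadraticAlgebra k e 0) ^ 2 = algebraMap k _ e := by
      rw [pow_two, QuadraticAlgebra.omega_mul_omega_eq_algebraMap, map_zero, zero_mul,
        add_zero]
    conv_lhs => rw [← Nat.div_add_mod (Fintype.card k) 2, FiniteField.odd_card_of_char_ne_two hchar,
      pow_succ, pow_mul, hsq, ← map_pow, heuler, map_neg, map_one, neg_one_mul]
  calc m ^ Fintype.card k
    _ = FiniteField.frobeniusAlgHom k (QuadraticAlgebra k e 0)
        (algebraMap k _ m.re + m.im • QuadraticAlgebra.omega) := by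
      rw [← QuadraticAlgebra.mk_eq_add_smul_omega, FiniteField.frobeniusAlgHom_apply]
    _ = algebraMap k _ m.re + m.im • -QuadraticAlgebra.omega := by
      rw [map_add, AlgHom.commutes, map_smul, FiniteField.frobeniusAlgHom_apply, homega]
    _ = star m := by ext <;> simp

variable {F : Type*} [Field F] [ValuativeRel F]

/-- The reduction map onto the residue field of `F(√ε)`. -/
noncomputable def unramifiedResidue {ε : 𝒪[F]} (hε : ¬ IsSquare (residue 𝒪[F] ε)) :
    (unramifiedValuation hε).integer →+* QuadraticAlgebra 𝓀[F] (residue 𝒪[F] ε) 0 where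
  toFun x := ⟨residue 𝒪[F] ⟨x.1.re, ((unramifiedValuation_le_one_iff hε).1 x.2).1⟩,
    residue 𝒪[F] ⟨x.1.im, ((unramifiedValuation_le_one_iff hε).1 x.2).2⟩⟩
  map_zero' := by ext <;> exact map_zero _
  map_one' := by
    ext
    exacts [map_one _, map_zero _]
  map_add' x y := by
    ext <;> simp only [QuadraticAlgebra.re_add, QuadraticAlgebra.im_add, ← map_add] <;> rfl
  map_mul' x y := by
    ext <;> simp only [QuadraticAlgebra.re_mul, QuadraticAlgebra.im_mul, zero_mul, add_zero,
      ← map_mul, ← map_add, Subring.coe_mul] <;> rfl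

variable {ε : 𝒪[F]} (hε : ¬ IsSquare (residue 𝒪[F] ε))

theorem unramifiedResidue_surjective : Function.Surjective (unramifiedResidue hε) := fun y => by
  obtain ⟨a, ha⟩ := residue_surjective y.re
  obtain ⟨b, hb⟩ := residue_surjective y.im
  exact ⟨⟨⟨a, b⟩, (unramifiedValuation_le_one_iff hε).2 ⟨a.2, b.2⟩⟩,
    QuadraticAlgebra.ext ha hb⟩

theorem unramifiedResidue_eq_zero_iff (x : (unramifiedValuation hε).integer) :
    unramifiedResidue hε x = 0 ↔ unramifiedValuation hε x < 1 := by
  rw [unramifiedValuation_lt_one_iff, QuadraticAlgebra.ext_iff]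
  exact and_congr (residue_eq_zero_iff_valuation_lt_one _) (residue_eq_zero_iff_valuation_lt_one _)

theorem unramifiedResidue_eq_iff (x y : (unramifiedValuation hε).integer) :
    unramifiedResidue hε x = unramifiedResidue hε y ↔ unramifiedValuation hε (x - y) < 1 := by
  rw [← sub_eq_zero, ← map_sub, unramifiedResidue_eq_zero_iff]
  rfl

variable [TopologicalSpace F] [IsNonarchimedeanLocalField F]

theorem exists_residueField_generator :
    ∃ ζ : QuadraticAlgebra F (ε : F) 0, unramifiedValuation hε ζ = 1 ∧
      (∀ m, unramifiedValuation hε m = 1 → ∃ i : ℕ, unramifiedValuation hε (m - ζ ^ i) < 1) ∧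
      (∀ i : ℕ, unramifiedValuation hε (1 - ζ ^ i) < 1 → Nat.card 𝓀[F] ^ 2 - 1 ∣ i) ∧
      unramifiedValuation hε (star ζ - ζ ^ Nat.card 𝓀[F]) < 1 := by
  let k' := QuadraticAlgebra 𝓀[F] (residue 𝒪[F] ε) 0
  have : Fact (∀ r : 𝓀[F], r ^ 2 ≠ residue 𝒪[F] ε + 0 * r) :=
    ⟨sq_ne_add_zero_mul_of_not_isSquare hε⟩
  have : Finite k' := Finite.of_equiv _ (QuadraticAlgebra.equivProd _ _).symm
  obtain ⟨g, hg⟩ := IsCyclic.exists_generator (α := k'ˣ)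
  obtain ⟨ζ, hζ⟩ := unramifiedResidue_surjective hε g
  have hres1 {x : (unramifiedValuation hε).integer} :
      unramifiedResidue hε x ≠ 0 ↔ unramifiedValuation hε x = 1 := by
    rw [Ne, unramifiedResidue_eq_zero_iff, not_lt]
    exact ⟨x.2.antisymm, ge_of_eq⟩
  have hord : orderOf g = Nat.card 𝓀[F] ^ 2 - 1 := by
    rw [orderOf_eq_card_of_forall_mem_zpowers hg, Nat.card_units,
      Nat.card_congr (QuadraticAlgebra.equivProd _ _), Nat.card_prod, pow_two]
  refine ⟨ζ, hres1.1 (hζ ▸ g.ne_zero), fun m hm => ?_, fun i hi => ?_, ?_⟩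
  · obtain ⟨i, hi⟩ := (mem_powers_iff_mem_zpowers (x := g)).2
      (hg (Units.mk0 _ ((hres1 (x := ⟨m, hm.le⟩)).2 hm)))
    refine ⟨i, (unramifiedResidue_eq_iff hε ⟨m, hm.le⟩ (ζ ^ i)).1 ?_⟩
    rw [map_pow, hζ]
    exact (congrArg Units.val hi).symm
  · have hi' := (unramifiedResidue_eq_iff hε 1 (ζ ^ i)).2 hi
    rw [map_pow, map_one, hζ] at hi'
    rw [← hord, orderOf_dvd_iff_pow_eq_one]
    exact Units.ext hi'.symm
  · have hstar : unramifiedValuation hε (star (ζ : QuadraticAlgebra F (ε : F) 0)) ≤ 1 := by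
      rw [unramifiedValuation_le_one_iff]
      simpa using (unramifiedValuation_le_one_iff hε).1 ζ.2
    refine (unramifiedResidue_eq_iff hε ⟨_, hstar⟩ (ζ ^ Nat.card 𝓀[F])).1 ?_
    rw [map_pow, quadraticAlgebra_pow_card_eq_star hε]
    ext
    · simp [unramifiedResidue]
    · simp only [unramifiedResidue, RingHom.coe_mk, MonoidHom.coe_mk, OneHom.coe_mk,
        QuadraticAlgebra.im_star, ← map_neg]
      rfl

end ResidueField

section UnramifiedTorus

open ValuativeRel IsLocalRing Quaternion

theorem quaternionAlgebra_j_sq {R : Type*} [CommRing R] (a b : R) :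
    (⟨0, 0, 1, 0⟩ : ℍ[R,a,0,b]) ^ 2 = algebraMap R _ b := by
  rw [pow_two]
  ext <;> simp

theorem quaternionAlgebra_j_mul_mk {R : Type*} [CommRing R] {a b : R} (m : QuadraticAlgebra R a 0) :
    (⟨0, 0, 1, 0⟩ * ⟨m.re, m.im, 0, 0⟩ : ℍ[R,a,0,b]) =
      ⟨(star m).re, (star m).im, 0, 0⟩ * ⟨0, 0, 1, 0⟩ := by
  ext <;> simp

variable {F : Type*} [Field F] [ValuativeRel F] [TopologicalSpace F] [IsNonarchimedeanLocalField F]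
  {ε π : 𝒪[F]} (hε : ¬ IsSquare (residue 𝒪[F] ε)) (hπ : Irreducible π)

section

variable {D : Type*} [Ring D] [Algebra F D]
  (e : ℍ[F,(ε : F),0,(π : F)] ≃ₐ[F] D) {W : Valuation D (ValueGroupWithZero F)}
  (hW : ∀ x, W (e x) = quaternionValuation hε hπ x)

include hW

theorem valuation_smul_eq_sq_mul (a : F) (x : D) : W (a • x) = valuation F a ^ 2 * W x := by
  obtain ⟨y, rfl⟩ := e.surjective x
  rw [← map_smul, hW, hW, quaternionValuation_smul]

theorem exists_valuation_eq_zpow_of_quaternionValuation {x : D} (hx : W x ≠ 0) :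
    ∃ n : ℤ, W x = valuation F π ^ n := by
  obtain ⟨y, rfl⟩ := e.surjective x
  rw [hW] at hx ⊢
  exact exists_quaternionValuation_eq_zpow hε hπ hx

theorem exists_valuation_sub_pow_lt_one {φ : QuadraticAlgebra F (ε : F) 0 →ₐ[F] D}
    (hφ : ∀ m, e ⟨m.re, m.im, 0, 0⟩ = φ m) {ζ : QuadraticAlgebra F (ε : F) 0}
    (hζ : ∀ m, unramifiedValuation hε m = 1 → ∃ n : ℕ, unramifiedValuation hε (m - ζ ^ n) < 1)
    {x : D} (hx : W x = 1) : ∃ n : ℕ, W (x - φ ζ ^ n) < 1 := by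
  obtain ⟨y, rfl⟩ := e.surjective x
  rw [hW] at hx
  obtain ⟨m, hm, hlt⟩ := exists_unramifiedValuation_eq_one_of_quaternionValuation_eq_one hε hπ hx
  obtain ⟨n, hn⟩ := hζ m hm
  rw [← hW, map_sub, hφ] at hlt
  rw [← quaternionValuation_mk_re_imI hε hπ, ← hW, hφ, map_sub, map_pow] at hn
  exact ⟨n, sub_add_sub_cancel (e y) (φ m) (φ ζ ^ n) ▸ W.map_add_lt hlt hn⟩

theorem exists_isCompact_setOf_valuation_le_one_subset [TopologicalSpace D]
    [IsModuleTopology F D] :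
    ∃ C : Set D, IsCompact C ∧ {x | W x ≤ 1} ⊆ C := by
  have := IsModuleTopology.topologicalAddGroup F D
  have := IsModuleTopology.toContinuousSMul F D
  let f : (Fin 4 → F) →ₗ[F] D :=
    e.toLinearMap ∘ₗ (QuaternionAlgebra.linearEquivTuple (ε : F) 0 (π : F)).symm.toLinearMap
  refine ⟨f '' Set.univ.pi fun _ => {a | valuation F a ≤ 1}, (isCompact_univ_pi fun _ =>
    IsNonarchimedeanLocalField.isCompact_closedBall F 1).image
      (IsModuleTopology.continuous_of_linearMap f), fun x hx => ?_⟩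
  obtain ⟨y, rfl⟩ := e.surjective x
  rw [Set.mem_ofPred_eq, hW, quaternionValuation_le_one_iff, unramifiedValuation_le_one_iff,
    unramifiedValuation_le_one_iff] at hx
  refine ⟨![y.re, y.imI, y.imJ, y.imK], fun i _ => ?_, rfl⟩
  fin_cases i
  exacts [hx.1.1, hx.1.2, hx.2.1, hx.2.2]

end

variable {D : Type*} [DivisionRing D] [Algebra F D] [TopologicalSpace D] [IsModuleTopology F D]
  {e : ℍ[F,(ε : F),0,(π : F)] ≃ₐ[F] D}

theorem hasOddNormalBasis_principalUnits_of_quaternionValuation (hF : ringChar 𝓀[F] ≠ 2)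
    {W : Valuation D (ValueGroupWithZero F)} (hW : ∀ x, W (e x) = quaternionValuation hε hπ x) :
    HasOddNormalBasis (principalUnits W 1) := by
  have : Module.Finite F D := Module.Finite.equiv e.toLinearEquiv
  have := IsModuleTopology.isTopologicalRing F D
  have hsmul := valuation_smul_eq_sq_mul hε hπ e hW
  have h2 : W 2 = 1 := by
    have htwo : (2 : D) = (2 : F) • 1 := by rw [← Algebra.algebraMap_eq_smul_one, map_ofNat]
    rw [htwo, hsmul, valuation_two hF, one_pow, map_one, one_mul]
  obtain ⟨C, hC, hWC⟩ := exists_isCompact_setOf_valuation_le_one_subset hε hπ e hW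
  exact hasOddNormalBasis_principalUnits_one (hasBasis_nhds_zero_of_isCompact hsmul hC hWC) hC hWC
    h2

include hε hπ in
theorem TwoFoldCover.extensionSplits_of_algEquiv_quaternionAlgebra (hF : ringChar 𝓀[F] ≠ 2)
    {φ : QuadraticAlgebra F (ε : F) 0 →ₐ[F] D} (hφ : ∀ m, e ⟨m.re, m.im, 0, 0⟩ = φ m)
    {E : Type*} [Group E] [TopologicalSpace E] [IsTopologicalGroup E] (c : TwoFoldCover Dˣ E)
    {A : Subgroup Dˣ} (hφA : ∀ x : Dˣ, (x : D) ∈ φ.range → x ∈ A)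
    (hA : ExtensionSplitsOver c.complexProj A) : ExtensionSplits c.complexProj := by
  have : Module.Finite F D := Module.Finite.equiv e.toLinearEquiv
  have := IsModuleTopology.isTopologicalRing F D
  obtain ⟨W, hW⟩ : ∃ W : Valuation D (ValueGroupWithZero F),
      ∀ x, W (e x) = quaternionValuation hε hπ x :=
    ⟨(quaternionValuation hε hπ).comap (e.symm : D →+* ℍ[F,(ε : F),0,(π : F)]), fun x =>
      congrArg (quaternionValuation hε hπ) (e.symm_apply_apply x)⟩
  have hWφ (m) : W (φ m) = unramifiedValuation hε m := by
    rw [← hφ, hW, quaternionValuation_mk_re_imI]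
  obtain ⟨ζ, hζ, hζgen, hζord, hζstar⟩ := exists_residueField_generator hε
  have hz0 : φ ζ ≠ 0 := (Valuation.ne_zero_iff W).1 (by rw [hWφ, hζ]; exact one_ne_zero)
  have hWj : W (e ⟨0, 0, 1, 0⟩) = valuation F π := (hW _).trans (quaternionValuation_j hε hπ)
  have hj0 : e ⟨0, 0, 1, 0⟩ ≠ 0 := (Valuation.ne_zero_iff W).1
    (by rw [hWj]; exact valuation_ne_zero_of_irreducible hπ)
  have hj2 : ((Units.mk0 _ hj0 ^ 2 : Dˣ) : D) = algebraMap F D π := by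
    rw [Units.val_pow_eq_pow_val, Units.val_mk0, ← map_pow, quaternionAlgebra_j_sq, e.commutes]
  have hconj : e ⟨0, 0, 1, 0⟩ * φ ζ * (e ⟨0, 0, 1, 0⟩)⁻¹ = φ (star ζ) := by
    rw [mul_inv_eq_iff_eq_mul₀ hj0, ← hφ, ← hφ, ← map_mul, ← map_mul, quaternionAlgebra_j_mul_mk]
  have hord (n : ℕ) (hn : W (1 - φ ζ ^ n) < 1) : Nat.card 𝓀[F] ^ 2 - 1 ∣ n := hζord n (by
    rwa [← map_pow, ← map_one φ, ← map_sub, hWφ] at hn)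
  have hgen (x : Dˣ) : ∃ n : ℤ, W (x : D) = W (e ⟨0, 0, 1, 0⟩) ^ n :=
    hWj ▸ exists_valuation_eq_zpow_of_quaternionValuation hε hπ e hW
      ((Valuation.ne_zero_iff W).2 x.ne_zero)
  refine c.extensionSplits_of_hasOddNormalBasis_principalUnits
    (hasOddNormalBasis_principalUnits_of_quaternionValuation hε hπ hF hW)
    (z := Units.mk0 _ hz0) (w := Units.mk0 _ hj0) Finite.one_lt_card ((hWφ ζ).trans hζ)
    (fun _ => exists_valuation_sub_pow_lt_one hε hπ e hW hφ hζgen) hord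
    (hWj.trans_lt (valuation_lt_one_of_irreducible hπ)) hgen ?_ (hφA _ (φ.mem_range_self ζ))
    (hφA _ ⟨algebraMap F _ π, (φ.commutes _).trans hj2.symm⟩) (Units.ext ?_) hA
  · rw [Units.val_mul, Units.val_mul, Units.val_inv_eq_inv_val, Units.val_mk0, Units.val_mk0, hconj,
      ← map_pow, ← map_sub, hWφ]
    exact hζstar
  · rw [Units.val_mul, Units.val_mul, hj2]
    exact (Algebra.commutes (π : F) _).symm

end UnramifiedTorus

theorem proposition4p5
    {F : Type*} [Field F] [ValuativeRel F] [TopologicalSpace F] [IsNonarchimedeanLocalField F]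
    (hF : ringChar 𝓀[F] ≠ 2)
    {D : Type*} [DivisionRing D] [Algebra F D] [Algebra.IsCentral F D]
    (hD : Module.finrank F D = 4)
    [TopologicalSpace D] [IsModuleTopology F D]
    {M : Type*} [Field M] [Algebra F M] (hM : Module.finrank F M = 2)
    (hM' : IsUnramifiedExtension F M) (i : M →ₐ[F] D)
    {E : Type*} [Group E] [TopologicalSpace E] [IsTopologicalGroup E]
    (c : TwoFoldCover Dˣ E) (hc : ¬ ExtensionSplits c.complexProj) :
    ¬ ExtensionSplitsOver c.proj.toMonoidHom (Units.map (i : M →* D)).range ∧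
      ¬ ExtensionSplitsOver c.complexProj (Units.map (i : M →* D)).range := by
  have h : ¬ ExtensionSplitsOver c.complexProj (Units.map (i : M →* D)).range := by
    intro hsplit
    obtain ⟨ε, hε, ⟨ψ⟩⟩ := hM'.exists_algEquiv_quadraticAlgebra hF hM
    obtain ⟨π, hπ, e, he⟩ := exists_algEquiv_quaternionAlgebra_irreducible hF hD hε
      (i.comp (ψ : QuadraticAlgebra F (ε : F) 0 →ₐ[F] M))
    refine hc (c.extensionSplits_of_algEquiv_quaternionAlgebra hε hπ hF he ?_ hsplit)
    rintro x ⟨m, hm : i (ψ m) = x⟩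
    have hm0 : ψ m ≠ 0 := fun h0 => x.ne_zero (by rw [← hm, h0, map_zero])
    exact ⟨Units.mk0 (ψ m) hm0, Units.ext hm⟩
  exact ⟨fun h' => h (c.extensionSplitsOver_complexProj h'), h⟩
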